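/- Let $\mathbb F$ be an arbitrary field and let $d\ge 1$ be an integer. Let $\mathcal L$ be a set of lines in $\mathbb F^d$ (one-dimensional affine subspaces), and let $\mathcal J$ be a set of points of $\mathbb F^d$ each of which is a joint formed by $\mathcal L$, that is, each $p\in\mathcal J$ lies on $d$ lines of $\mathcal L$ whose directions are linearly independent. (Not every joint formed by $\mathcal L$ needs to be in $\mathcal J$.) For a real number $x$ and an integer $k\ge 0$ write $\binom{x}{k}=\frac{x(x-1)\cdots(x-k+1)}{k!}$. If $|\mathcal J|=\binom{x}{d}$ for some real number $x\ge d$, then $|\mathcal L|\ge\binom{x}{d-1}$ (which holds trivially when $\mathcal L$ is infinite). -/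

import Mathlib

open scoped ENNReal

/-- A line in `F^d`: an affine subspace whose direction is one-dimensional.
(The empty affine subspace has direction `⊥`, so a line is automatically non-empty.) -/
def IsLine {F : Type*} [Field F] {d : ℕ} (ℓ : AffineSubspace F (Fin d → F)) : Prop :=
  Module.finrank F ℓ.direction = 1

/-- `p` is a joint formed by the set of lines `L` in `F^d`: it lies on `d` lines of `L`
that have linearly independent direction vectors. -/
def IsJoint {F : Type*} [Field F] {d : ℕ} (L : Set (AffineSubspace F (Fin d → F)))
    (p : Fin d → F) : Prop :=
  ∃ (ℓ : Fin d → AffineSubspace F (Fin d → F)) (v : Fin d → (Fin d → F)),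
    (∀ i, ℓ i ∈ L ∧ p ∈ ℓ i ∧ v i ∈ (ℓ i).direction) ∧ LinearIndependent F v

/-- `(J, L)` is a joints configuration in `F^d`: `L` is a set of lines, and `J` is a set of points
each of which is a joint formed by `L` (not necessarily all of the joints). -/
structure IsJointsConfiguration {F : Type*} [Field F] {d : ℕ} (J : Set (Fin d → F))
    (L : Set (AffineSubspace F (Fin d → F))) : Prop where
  isLine : ∀ ℓ ∈ L, IsLine ℓ
  isJoint : ∀ p ∈ J, IsJoint L p

/-! Fix for each joint `p` lines `ℓ p 0, …, ℓ p (d-1)` with independent directions. Let m(p,i) be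
the number of joints that chose the line `ℓ p i`, M_p the geometric mean of m(p,i) over i, and y the
geometric mean of the M_p. The sum of all 1/m(p,i) counts the chosen lines, so AM-GM gives d|J| ≤
y·#lines (`mul_card_le_meanRichness_mul_card`). Since d·C(x,d) = (x-d+1)·C(x,d-1), it suffices to
have y ≤ x-d+1, and this follows from y(y+1)⋯(y+d-1) ≤ d!|J|. That inequality is proved for
configurations connected through their chosen lines (`prod_meanRichness_add_le`); in general the
components are bounded separately and added (`mul_card_le_mul_card_lines`).

The connected case is the polynomial method with integer handicaps a_p. A polynomial of degree at
most n vanishes once, at each p, the Taylor coefficients in the chosen directions vanish for those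
exponents γ with ∑_q max(γ_i + a_p - a_q, 0) + ∑_{k≠i} γ_k ≤ n for all i, where q runs over the
points on `ℓ p i`. Hence C(n+d,d) is at most the total number of such γ (`choose_le_sum_card`).

For a_p = ⌊n α_p⌋ the exponents at p lie in a polytope (m_i - 1)x_i + ∑ x_k ≤ b_i. A multiplicative
Prékopa–Leindler inequality, applied to its cyclic rotations, bounds its volume by ∏ b_i / Q_p with
Q_p = M_p(M_p+1)⋯(M_p+d-1) (`volume_polytope_le`). By AM-GM ∏ b_i is at most about (n T_p)^d, where
the Laplacian of α at p is d(1 - T_p). Connectedness makes every T with ∑ T_p = |J| attainable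
(`exists_collinearityLaplacian_eq`). Taking T_p proportional to Q_p^{1/d} and letting n → ∞ bounds
the d-th power of the mean of Q_p^{1/d} by d!|J|, and this power dominates y(y+1)⋯(y+d-1)
(`prod_add_le_mean_pow`). -/

/-! ### One-dimensional Brunn–Minkowski inequality. -/

section BrunnMinkowski

open MeasureTheory Set
open scoped Pointwise

/-- One-dimensional Brunn–Minkowski inequality for compact sets. -/
theorem volume_add_volume_le_volume_add {A B : Set ℝ} (hA : IsCompact A) (hA' : A.Nonempty)
    (hB : IsCompact B) (hB' : B.Nonempty) : volume A + volume B ≤ volume (A + B) := by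
  obtain ⟨a, ha, ha_max⟩ := hA.exists_isGreatest hA'
  obtain ⟨b, hb, hb_min⟩ := hB.exists_isLeast hB'
  -- With a = max A and b = min B, these two translates lie in A + B and can meet only at a + b.
  have hsub : (b +ᵥ A) ∪ (a +ᵥ B) ⊆ A + B := by
    rintro x (⟨y, hy, rfl⟩ | ⟨y, hy, rfl⟩)
    · exact ⟨y, hy, b, hb, add_comm _ _⟩
    · exact ⟨a, ha, y, hy, rfl⟩
  have hinter : (b +ᵥ A) ∩ (a +ᵥ B) ⊆ {a + b} := by
    rintro x ⟨⟨y, hy, rfl⟩, ⟨z, hz, hyz⟩⟩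
    have h1 := ha_max hy
    have h2 := hb_min hz
    simp only [vadd_eq_add, mem_singleton_iff] at *
    linarith
  have hdisj : AEDisjoint volume (b +ᵥ A) (a +ᵥ B) :=
    measure_mono_null hinter (by simp)
  have hmeas : MeasurableSet (a +ᵥ B) := (hB.vadd a).measurableSet
  calc volume A + volume B = volume (b +ᵥ A) + volume (a +ᵥ B) := by
        rw [measure_vadd, measure_vadd]
    _ = volume ((b +ᵥ A) ∪ (a +ᵥ B)) := (measure_union₀ hmeas.nullMeasurableSet hdisj).symm
    _ ≤ _ := measure_mono hsub

theorem sum_volume_le_volume_sum {ι : Type*} (s : Finset ι) {K : ι → Set ℝ}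
    (hK : ∀ i, IsCompact (K i)) (hK' : ∀ i, (K i).Nonempty) :
    IsCompact (∑ i ∈ s, K i) ∧ (∑ i ∈ s, K i).Nonempty ∧
      ∑ i ∈ s, volume (K i) ≤ volume (∑ i ∈ s, K i) := by
  classical
  induction s using Finset.induction_on with
  | empty => simp
  | insert a s ha ih =>
    obtain ⟨h1, h2, h3⟩ := ih
    rw [Finset.sum_insert ha, Finset.sum_insert ha]
    refine ⟨(hK a).add h1, (hK' a).add h2, ?_⟩
    exact (add_le_add le_rfl h3).trans
      (volume_add_volume_le_volume_add (hK a) (hK' a) h1 h2)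

/-- Inner regularity reduces this to compact sets; `C` need not be measurable. -/
theorem sum_volume_le_of_forall_sum_mem {ι : Type*} [Fintype ι] {A : ι → Set ℝ} {C : Set ℝ}
    (hA : ∀ i, MeasurableSet (A i)) (hA' : ∀ i, (A i).Nonempty)
    (hC : ∀ x : ι → ℝ, (∀ i, x i ∈ A i) → ∑ i, x i ∈ C) :
    ∑ i, volume (A i) ≤ volume C := by
  have key : ∀ r : ι → ℝ≥0∞, (∀ i, r i < volume (A i) ∨ r i = 0) → ∑ i, r i ≤ volume C := by
    intro r hr
    have : ∀ i, ∃ K, K ⊆ A i ∧ IsCompact K ∧ K.Nonempty ∧ r i ≤ volume K := by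
      intro i
      rcases hr i with h | h
      · obtain ⟨K, hK1, hK2, hK3⟩ := (hA i).exists_lt_isCompact h
        refine ⟨K, hK1, hK2, ?_, hK3.le⟩
        by_contra hne
        rw [not_nonempty_iff_eq_empty] at hne
        simp [hne] at hK3
      · obtain ⟨x, hx⟩ := hA' i
        exact ⟨{x}, by simpa using hx, isCompact_singleton, by simp, by simp [h]⟩
    choose K hK1 hK2 hK3 hK4 using this
    calc ∑ i, r i ≤ ∑ i, volume (K i) := Finset.sum_le_sum fun i _ => hK4 i
      _ ≤ volume (∑ i, K i) := (sum_volume_le_volume_sum _ hK2 hK3).2.2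
      _ ≤ volume C := by
        refine measure_mono fun y hy => ?_
        rw [Set.mem_fintype_sum] at hy
        obtain ⟨g, hg, rfl⟩ := hy
        exact hC g fun i => hK1 i (hg i)
  by_cases htop : ∃ i, volume (A i) = ∞
  · obtain ⟨i, hi⟩ := htop
    classical
    have : volume C = ∞ := by
      refine ENNReal.eq_top_of_forall_nnreal_le fun t => ?_
      have := key (Pi.single i (t : ℝ≥0∞)) (fun j => by
        by_cases hj : j = i
        · subst hj; left; simp [hi]
        · right; simp [hj])
      simpa using this
    simp [this]
  · push Not at htop
    refine ENNReal.le_of_forall_pos_le_add fun ε hε hCt => ?_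
    rcases isEmpty_or_nonempty ι with h | h
    · simp
    have hN : (0 : ℝ≥0∞) < Fintype.card ι := by exact_mod_cast Fintype.card_pos
    have hδ : (ε : ℝ≥0∞) / Fintype.card ι ≠ 0 := by
      simp [ENNReal.div_eq_zero_iff, hε.ne']
    have h1 := key (fun i => volume (A i) - ε / Fintype.card ι) (fun i => by
      by_cases h0 : volume (A i) = 0
      · right; simp [h0]
      · left; exact ENNReal.sub_lt_self (htop i) h0 hδ)
    calc ∑ i, volume (A i)
        ≤ ∑ i, ((volume (A i) - ε / Fintype.card ι) + ε / Fintype.card ι) :=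
          Finset.sum_le_sum fun i _ => le_tsub_add
      _ = ∑ i, (volume (A i) - ε / Fintype.card ι) + ε := by
          rw [Finset.sum_add_distrib]
          congr 1
          rw [Finset.sum_const, Finset.card_univ, nsmul_eq_mul,
            ENNReal.mul_div_cancel hN.ne' (by simp)]
      _ ≤ _ := by gcongr

end BrunnMinkowski

/-! ### Prékopa–Leindler inequalities, ending with the multiplicative form on the positive orthant.
-/

section PrekopaLeindler

open MeasureTheory Set

/-- Layer-cake formula, with Brunn–Minkowski at each height t. Below 1 every superlevel set of `u i`
is non-empty, as Brunn–Minkowski requires; from 1 on all of them are empty. -/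
theorem sum_lintegral_le_of_superlevel {ι : Type*} [Fintype ι] [Nonempty ι] {u : ι → ℝ → ℝ}
    {w : ℝ → ℝ} (hu : ∀ i, Measurable (u i)) (hw : Measurable w)
    (hu0 : ∀ i x, 0 ≤ u i x) (hu1 : ∀ i x, u i x ≤ 1) (hw0 : ∀ x, 0 ≤ w x)
    (hsup : ∀ i, ∀ t < 1, ∃ x, t < u i x)
    (h : ∀ t > 0, ∀ x : ι → ℝ, (∀ i, t < u i (x i)) → t < w ((∑ i, x i) / Fintype.card ι)) :
    ∑ i, ∫⁻ x, ENNReal.ofReal (u i x) ≤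
      Fintype.card ι * ∫⁻ x, ENNReal.ofReal (w x) := by
  have hN : (0 : ℝ) < Fintype.card ι := by exact_mod_cast Fintype.card_pos
  have lc : ∀ f : ℝ → ℝ, Measurable f → (∀ x, 0 ≤ f x) →
      ∫⁻ x, ENNReal.ofReal (f x) = ∫⁻ t in Ioi 0, volume {x | t < f x} := fun f hf hf0 =>
    lintegral_eq_lintegral_meas_lt _ (Filter.Eventually.of_forall hf0) hf.aemeasurable
  have hmeas : ∀ f : ℝ → ℝ, Measurable fun t => volume {x | t < f x} := fun f =>
    Antitone.measurable fun s t hst => measure_mono fun x hx => lt_of_le_of_lt hst hx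
  simp_rw [lc _ (hu _) (hu0 _)]
  rw [lc _ hw hw0, ← lintegral_finsetSum _ fun i _ => hmeas _, ← lintegral_const_mul _ (hmeas _)]
  refine setLIntegral_mono ((hmeas _).const_mul _) fun t ht => ?_
  rcases lt_or_ge t 1 with ht1 | ht1
  · have hscale : (Fintype.card ι : ℝ≥0∞) * volume {x | t < w x} =
        volume ((fun x => (Fintype.card ι : ℝ)⁻¹ * x) ⁻¹' {x | t < w x}) := by
      rw [Real.volume_preimage_mul_left (inv_ne_zero hN.ne')]
      simp
    rw [hscale]
    refine sum_volume_le_of_forall_sum_mem (fun i => measurableSet_lt measurable_const (hu i))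
      (fun i => hsup i t ht1) fun x hx => ?_
    have := h t ht x hx
    simpa [div_eq_inv_mul] using this
  · have : ∀ i, {x | t < u i x} = ∅ := fun i => by
      ext x; simpa using (hu1 i x).trans ht1
    simp [this]

end PrekopaLeindler

section PrekopaLeindler

open MeasureTheory Set

theorem ENNReal.prod_rpow_inv_card_const {ι : Type*} [Fintype ι] [Nonempty ι] (t : ℝ≥0∞) :
    ∏ _i : ι, t ^ (Fintype.card ι : ℝ)⁻¹ = t := by
  have hN : (Fintype.card ι : ℝ) ≠ 0 := by exact_mod_cast Fintype.card_ne_zero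
  rw [Finset.prod_const, Finset.card_univ, ← ENNReal.rpow_natCast, ← ENNReal.rpow_mul,
    inv_mul_cancel₀ hN, ENNReal.rpow_one]

/-- The inequality of the geometric and arithmetic means in `ℝ≥0∞`. -/
theorem ENNReal.prod_rpow_inv_card_le {ι : Type*} [Fintype ι] [Nonempty ι] (z : ι → ℝ≥0∞) :
    ∏ i, z i ^ (Fintype.card ι : ℝ)⁻¹ ≤ (∑ i, z i) / Fintype.card ι := by
  have hN : (0 : ℝ) < Fintype.card ι := by exact_mod_cast Fintype.card_pos
  by_cases htop : ∃ i, z i = ∞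
  · obtain ⟨i, hi⟩ := htop
    have : ∑ i, z i = ∞ := ENNReal.sum_eq_top.2 ⟨i, Finset.mem_univ i, hi⟩
    rw [this, ENNReal.top_div_of_ne_top (by simp)]
    exact le_top
  · push Not at htop
    lift z to ι → NNReal using htop
    have h := NNReal.geom_mean_le_arith_mean_weighted Finset.univ
      (fun _ : ι => (Fintype.card ι : NNReal)⁻¹) z (by
        rw [Finset.sum_const, Finset.card_univ, nsmul_eq_mul, mul_inv_cancel₀]
        exact_mod_cast Fintype.card_ne_zero)
    rw [← Finset.mul_sum] at h
    have h' : ((∏ i, z i ^ (Fintype.card ι : ℝ)⁻¹ : NNReal) : ℝ≥0∞) ≤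
        (((Fintype.card ι : NNReal)⁻¹ * ∑ i, z i : NNReal) : ℝ≥0∞) := by
      exact_mod_cast h
    have e1 : ((∏ i, z i ^ (Fintype.card ι : ℝ)⁻¹ : NNReal) : ℝ≥0∞) =
        ∏ i, (z i : ℝ≥0∞) ^ (Fintype.card ι : ℝ)⁻¹ := by
      rw [ENNReal.ofNNReal_finsetProd]
      exact Finset.prod_congr rfl fun i _ => ENNReal.coe_rpow_of_nonneg _ (by positivity)
    rw [e1] at h'
    refine h'.trans (le_of_eq ?_)
    rw [ENNReal.coe_mul, ENNReal.coe_inv (by exact_mod_cast Fintype.card_ne_zero),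
      ENNReal.div_eq_inv_mul]
    simp

theorem ENNReal.ofReal_toReal_div_of_le {a S : ℝ≥0∞} (ha : a ≤ S) :
    ENNReal.ofReal (a / S).toReal = a / S :=
  ENNReal.ofReal_toReal (ne_top_of_le_ne_top ENNReal.one_ne_top
    ((ENNReal.div_le_div_right ha S).trans ENNReal.div_self_le_one))

/-- One-dimensional Prékopa–Leindler inequality for several bounded functions. -/
theorem prod_lintegral_rpow_le_lintegral {ι : Type*} [Fintype ι] [Nonempty ι]
    {f : ι → ℝ → ℝ≥0∞} {h : ℝ → ℝ≥0∞} (hf : ∀ i, Measurable (f i)) (hh : Measurable h)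
    {C : ℝ≥0∞} (hC : C ≠ ∞) (hfC : ∀ i x, f i x ≤ C)
    (hfh : ∀ x : ι → ℝ, ∏ i, f i (x i) ^ (Fintype.card ι : ℝ)⁻¹ ≤
      h ((∑ i, x i) / Fintype.card ι)) :
    ∏ i, (∫⁻ x, f i x) ^ (Fintype.card ι : ℝ)⁻¹ ≤ ∫⁻ x, h x := by
  have hN : (0 : ℝ) < Fintype.card ι := by exact_mod_cast Fintype.card_pos
  set S : ι → ℝ≥0∞ := fun i => ⨆ x, f i x 
  have hfS : ∀ i x, f i x ≤ S i := fun i x => le_iSup (f i) x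
  have hStop : ∀ i, S i ≠ ∞ := fun i => ne_top_of_le_ne_top hC (iSup_le fun x => hfC i x)
  by_cases hzero : ∃ i, S i = 0
  · obtain ⟨i, hi⟩ := hzero
    have : ∏ i, (∫⁻ x, f i x) ^ (Fintype.card ι : ℝ)⁻¹ = 0 := by
      refine Finset.prod_eq_zero (Finset.mem_univ i) ?_
      have : ∀ x, f i x = 0 := fun x => le_antisymm ((hfS i x).trans hi.le) bot_le
      simp [this, hN]
    simp [this]
  push Not at hzero
  set P : ℝ≥0∞ := ∏ i, S i ^ (Fintype.card ι : ℝ)⁻¹ with hP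
  have hP0 : P ≠ 0 := by
    rw [hP, Finset.prod_ne_zero_iff]
    intro i _
    rw [Ne, ENNReal.rpow_eq_zero_iff]
    simp [hzero i, hStop i]
  have hPtop : P ≠ ∞ := ENNReal.prod_ne_top fun i _ =>
    ENNReal.rpow_ne_top_of_nonneg (by positivity) (hStop i)
  -- Normalising every supremum to 1 makes the superlevel sets non-empty at the same heights.
  -- Truncating `w` at 1 keeps it finite and loses nothing, since `u ≤ 1`.
  set u : ι → ℝ → ℝ := fun i x => (f i x / S i).toReal with hu
  set w : ℝ → ℝ := fun x => (min (h x / P) 1).toReal with hw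
  have hou : ∀ i x, ENNReal.ofReal (u i x) = f i x / S i := fun i x =>
    ENNReal.ofReal_toReal_div_of_le (hfS i x)
  have how : ∀ x, ENNReal.ofReal (w x) = min (h x / P) 1 := fun x =>
    ENNReal.ofReal_toReal (ne_top_of_le_ne_top ENNReal.one_ne_top (min_le_right _ _))
  have hu1 : ∀ i x, u i x ≤ 1 := fun i x => by
    rw [← ENNReal.ofReal_le_one, hou]
    exact (ENNReal.div_le_div_right (hfS i x) _).trans ENNReal.div_self_le_one
  have key := sum_lintegral_le_of_superlevel (u := u) (w := w)
    (fun i => ((hf i).div_const _).ennreal_toReal)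
    (((hh.div_const _).min measurable_const).ennreal_toReal)
    (fun i x => ENNReal.toReal_nonneg) hu1 (fun x => ENNReal.toReal_nonneg)
    (by
      intro i t ht
      rcases lt_or_ge t 0 with ht0 | ht0
      · exact ⟨0, ht0.trans_le ENNReal.toReal_nonneg⟩
      have : ENNReal.ofReal t * S i < S i := by
        calc ENNReal.ofReal t * S i < 1 * S i := by
              refine ENNReal.mul_lt_mul_left (hzero i) (hStop i) ?_
              rwa [ENNReal.ofReal_lt_one]
          _ = S i := one_mul _
      obtain ⟨x, hx⟩ := lt_iSup_iff.1 this
      refine ⟨x, ?_⟩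
      rw [← ENNReal.ofReal_lt_ofReal_iff_of_nonneg ht0, hou]
      exact (ENNReal.lt_div_iff_mul_lt (Or.inl (hzero i)) (Or.inl (hStop i))).2 hx)
    (by
      intro t ht x hx
      obtain ⟨i₀, -, hi₀⟩ := Finset.exists_min_image Finset.univ (fun i => u i (x i))
        Finset.univ_nonempty
      refine (hx i₀).trans_le ?_
      rw [← ENNReal.ofReal_le_ofReal_iff ENNReal.toReal_nonneg, how]
      refine le_min ?_ (ENNReal.ofReal_le_one.2 (hu1 _ _))
      calc ENNReal.ofReal (u i₀ (x i₀))
          = ∏ _i : ι, ENNReal.ofReal (u i₀ (x i₀)) ^ (Fintype.card ι : ℝ)⁻¹ :=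
            (ENNReal.prod_rpow_inv_card_const _).symm
        _ ≤ ∏ i : ι, (f i (x i) / S i) ^ (Fintype.card ι : ℝ)⁻¹ := by
            refine Finset.prod_le_prod' fun i _ => ?_
            rw [← hou]
            exact ENNReal.rpow_le_rpow (ENNReal.ofReal_le_ofReal (hi₀ i (Finset.mem_univ i)))
              (by positivity)
        _ = (∏ i, f i (x i) ^ (Fintype.card ι : ℝ)⁻¹) / P := by
            rw [hP, ENNReal.div_eq_inv_mul, ENNReal.prod_inv_distrib, ← Finset.prod_mul_distrib]
            · refine Finset.prod_congr rfl fun i _ => ?_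
              rw [ENNReal.div_rpow_of_nonneg _ _ (by positivity), ENNReal.div_eq_inv_mul]
            · intro i _ j _ _
              right
              exact ENNReal.rpow_ne_top_of_nonneg (by positivity) (hStop _)
        _ ≤ _ := ENNReal.div_le_div_right (hfh x) _)
  have hintu : ∀ i, ∫⁻ x, ENNReal.ofReal (u i x) = (∫⁻ x, f i x) / S i := fun i => by
    simp_rw [hou, div_eq_mul_inv]
    exact lintegral_mul_const _ (hf i)
  have hintw : ∫⁻ x, ENNReal.ofReal (w x) ≤ (∫⁻ x, h x) / P := by
    simp_rw [how, div_eq_mul_inv]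
    rw [← lintegral_mul_const _ hh]
    exact lintegral_mono fun x => min_le_left _ _
  simp_rw [hintu] at key
  calc ∏ i, (∫⁻ x, f i x) ^ (Fintype.card ι : ℝ)⁻¹
      = P * ∏ i, ((∫⁻ x, f i x) / S i) ^ (Fintype.card ι : ℝ)⁻¹ := by
        rw [hP, ← Finset.prod_mul_distrib]
        refine Finset.prod_congr rfl fun i _ => ?_
        rw [← ENNReal.mul_rpow_of_nonneg _ _ (by positivity),
          ENNReal.mul_div_cancel (hzero i) (hStop i)]
    _ ≤ P * ((∑ i, (∫⁻ x, f i x) / S i) / Fintype.card ι) := by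
        gcongr
        exact ENNReal.prod_rpow_inv_card_le _
    _ ≤ P * ((∫⁻ x, h x) / P) := by
        refine mul_le_mul' le_rfl (ENNReal.div_le_of_le_mul' (key.trans ?_))
        gcongr
    _ = ∫⁻ x, h x := ENNReal.mul_div_cancel hP0 hPtop

/-- One-dimensional Prékopa–Leindler inequality on the positive half-line, for geometric means. -/
theorem prod_lintegral_Ioi_rpow_le_lintegral_Ioi {ι : Type*} [Fintype ι] [Nonempty ι]
    {f : ι → ℝ → ℝ≥0∞} {h : ℝ → ℝ≥0∞} (hf : ∀ i, Measurable (f i)) (hh : Measurable h)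
    {C : ℝ≥0∞} (hC : C ≠ ∞) {B : ℝ} (hfC : ∀ i x, f i x ≤ (Iic B).indicator (fun _ => C) x)
    (hfh : ∀ x : ι → ℝ, (∀ i, 0 < x i) → ∏ i, f i (x i) ^ (Fintype.card ι : ℝ)⁻¹ ≤
      h (∏ i, x i ^ (Fintype.card ι : ℝ)⁻¹)) :
    ∏ i, (∫⁻ x in Ioi 0, f i x) ^ (Fintype.card ι : ℝ)⁻¹ ≤ ∫⁻ x in Ioi 0, h x := by
  have hN : (0 : ℝ) < Fintype.card ι := by exact_mod_cast Fintype.card_pos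
  -- The substitution by `exp` turns geometric means into arithmetic ones, and its Jacobian is
  -- itself multiplicative. The support bound `B` keeps the Jacobian times `f i` bounded.
  have cv : ∀ g : ℝ → ℝ≥0∞, ∫⁻ x in Ioi 0, g x =
      ∫⁻ x, ENNReal.ofReal (Real.exp x) * g (Real.exp x) := fun g => by
    have := lintegral_image_eq_lintegral_abs_deriv_mul (s := univ) MeasurableSet.univ
      (fun x _ => (Real.hasDerivAt_exp x).hasDerivWithinAt) Real.exp_injective.injOn g
    rw [image_univ, Real.range_exp] at this
    rw [this, setLIntegral_univ]
    simp_rw [abs_of_pos (Real.exp_pos _)]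
  simp_rw [cv]
  refine prod_lintegral_rpow_le_lintegral (C := ENNReal.ofReal B * C)
    (fun i => Real.measurable_exp.ennreal_ofReal.mul ((hf i).comp Real.measurable_exp))
    (Real.measurable_exp.ennreal_ofReal.mul (hh.comp Real.measurable_exp))
    (ENNReal.mul_ne_top ENNReal.ofReal_ne_top hC) (fun i x => ?_) (fun x => ?_)
  · by_cases hx : Real.exp x ≤ B
    · gcongr
      refine (hfC i _).trans ?_
      rw [indicator_of_mem (by exact hx)]
    · have := hfC i (Real.exp x)
      rw [indicator_of_notMem (by exact hx)] at this
      simp [le_antisymm this bot_le]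
  · simp_rw [ENNReal.mul_rpow_of_nonneg _ _ (inv_nonneg.2 hN.le)]
    rw [Finset.prod_mul_distrib]
    have e : Real.exp ((∑ i, x i) / Fintype.card ι) =
        ∏ i, Real.exp (x i) ^ (Fintype.card ι : ℝ)⁻¹ := by
      simp_rw [← Real.exp_mul]
      rw [← Real.exp_sum, Finset.sum_div]
      simp_rw [div_eq_mul_inv]
    refine mul_le_mul' (le_of_eq ?_) ?_
    · rw [e, ENNReal.ofReal_prod_of_nonneg fun i _ => by positivity]
      exact Finset.prod_congr rfl fun i _ =>
        ENNReal.ofReal_rpow_of_nonneg (Real.exp_pos _).le (by positivity)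
    · rw [e]
      exact hfh _ fun i => Real.exp_pos _

/-- Prékopa–Leindler inequality on the positive orthant, for coordinatewise geometric means. -/
theorem prod_lintegral_pi_rpow_le_lintegral_pi {ι : Type*} [Fintype ι] [Nonempty ι]
    {C : ℝ≥0∞} (hC : C ≠ ∞) {B : ℝ} {d : ℕ}
    {f : ι → (Fin d → ℝ) → ℝ≥0∞} {h : (Fin d → ℝ) → ℝ≥0∞} (hf : ∀ i, Measurable (f i))
    (hh : Measurable h)
    (hfC : ∀ i x, f i x ≤ (pi univ fun _ => Ioc 0 B).indicator (fun _ => C) x)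
    (hfh : ∀ x : ι → Fin d → ℝ, (∀ i j, 0 < x i j) →
      ∏ i, f i (x i) ^ (Fintype.card ι : ℝ)⁻¹ ≤
        h fun j => ∏ i, x i j ^ (Fintype.card ι : ℝ)⁻¹) :
    ∏ i, (∫⁻ x, f i x) ^ (Fintype.card ι : ℝ)⁻¹ ≤ ∫⁻ x, h x := by
  induction d generalizing C with
  | zero =>
    have : ∀ g : (Fin 0 → ℝ) → ℝ≥0∞, ∫⁻ x, g x = g 0 := fun g => by
      rw [volume_pi, Measure.pi_of_empty _ 0, lintegral_dirac]
    simp_rw [this]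
    refine (hfh (fun _ => 0) (fun _ j => j.elim0)).trans (le_of_eq ?_)
    congr 1
    exact Subsingleton.elim _ _
  | succ d ih =>
    have hsymm : ∀ (t : ℝ) (y : Fin d → ℝ),
        (MeasurableEquiv.piFinSuccAbove (fun _ : Fin (d + 1) => ℝ) 0).symm (t, y) =
          Fin.cons t y := fun t y => by
      change Fin.insertNth (α := fun _ => ℝ) 0 t y = _
      exact Fin.insertNth_zero' t y
    have hcons : Measurable fun p : ℝ × (Fin d → ℝ) => (Fin.cons p.1 p.2 : Fin (d + 1) → ℝ) := by
      have := (MeasurableEquiv.piFinSuccAbove (fun _ : Fin (d + 1) => ℝ) 0).symm.measurable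
      have e : (fun p : ℝ × (Fin d → ℝ) => (Fin.cons p.1 p.2 : Fin (d + 1) → ℝ)) =
          (MeasurableEquiv.piFinSuccAbove (fun _ : Fin (d + 1) => ℝ) 0).symm :=
        funext fun p => (hsymm p.1 p.2).symm
      rw [e]
      exact this
    have split : ∀ g : (Fin (d + 1) → ℝ) → ℝ≥0∞, Measurable g →
        ∫⁻ x, g x = ∫⁻ t, ∫⁻ y, g (Fin.cons t y : Fin (d + 1) → ℝ) := fun g hg => by
      rw [← ((volume_preserving_piFinSuccAbove (fun _ : Fin (d + 1) => ℝ) 0).symm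
        |>.lintegral_comp hg), Measure.volume_eq_prod, lintegral_prod]
      · simp_rw [hsymm]
      · exact (hg.comp (MeasurableEquiv.measurable _)).aemeasurable
    have hmeas : ∀ g : (Fin (d + 1) → ℝ) → ℝ≥0∞, Measurable g →
        Measurable fun t => ∫⁻ y, g (Fin.cons t y : Fin (d + 1) → ℝ) := fun g hg =>
      (hg.comp hcons).lintegral_prod_right'
    have hslice : ∀ i t y, f i (Fin.cons t y : Fin (d + 1) → ℝ) ≤
        (Ioc 0 B).indicator (fun _ => (pi univ fun _ => Ioc 0 B).indicator (fun _ => C) y) t := by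
      intro i t y
      refine (hfC i _).trans ?_
      by_cases ht : t ∈ Ioc 0 B
      · by_cases hy : y ∈ pi univ fun _ : Fin d => Ioc 0 B
        · rw [indicator_of_mem ht, indicator_of_mem hy]
          exact indicator_le_self' (fun _ _ => bot_le) _
        · rw [indicator_of_notMem]
          · exact bot_le
          · intro hmem
            exact hy fun j _ => by simpa using hmem j.succ trivial
      · rw [indicator_of_notMem]
        · exact bot_le
        · intro hmem
          exact ht (by simpa using hmem 0 trivial)
    have hbox : volume (pi univ fun _ : Fin d => Ioc 0 B) ≠ ∞ := by
      rw [Real.volume_pi_Ioc]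
      exact ENNReal.prod_ne_top fun i _ => ENNReal.ofReal_ne_top
    have hmarg : ∀ i t, ∫⁻ y, f i (Fin.cons t y : Fin (d + 1) → ℝ) ≤ (Ioc 0 B).indicator
        (fun _ => C * volume (pi univ fun _ : Fin d => Ioc 0 B)) t := fun i t => by
      by_cases ht : t ∈ Ioc 0 B
      · rw [indicator_of_mem ht, ← lintegral_indicator_const
          (MeasurableSet.univ_pi fun _ => measurableSet_Ioc)]
        refine lintegral_mono fun y => (hslice i t y).trans ?_
        rw [indicator_of_mem ht]
      · rw [indicator_of_notMem ht, nonpos_iff_eq_zero, lintegral_eq_zero_iff]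
        · refine Filter.Eventually.of_forall fun y => ?_
          have := hslice i t y
          rw [indicator_of_notMem ht] at this
          exact le_antisymm this bot_le
        · exact (hf i).comp (hcons.comp measurable_prodMk_left)
    have hpos : ∀ i, ∫⁻ x, f i x =
        ∫⁻ t in Ioi 0, ∫⁻ y, f i (Fin.cons t y : Fin (d + 1) → ℝ) := fun i => by
      rw [split _ (hf i), ← lintegral_indicator measurableSet_Ioi]
      refine lintegral_congr fun t => ?_
      by_cases ht : t ∈ Ioi (0 : ℝ)
      · rw [indicator_of_mem ht]
      · rw [indicator_of_notMem ht]
        have := hmarg i t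
        rw [indicator_of_notMem (fun hmem => ht hmem.1)] at this
        exact le_antisymm this bot_le
    simp_rw [hpos]
    rw [split _ hh]
    refine le_trans ?_ (setLIntegral_le_lintegral (Ioi 0) _)
    refine prod_lintegral_Ioi_rpow_le_lintegral_Ioi (fun i => hmeas _ (hf i)) (hmeas _ hh)
      (ENNReal.mul_ne_top hC hbox) (B := B) (fun i t => (hmarg i t).trans ?_) (fun t ht => ?_)
    · exact indicator_le_indicator_of_subset Ioc_subset_Iic_self (fun _ => bot_le) _
    · refine ih hC (fun i => (hf i).comp (hcons.comp measurable_prodMk_left))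
        (hh.comp (hcons.comp measurable_prodMk_left)) (fun i y => (hslice i (t i) y).trans ?_)
        (fun y hy => ?_)
      · exact indicator_le_self' (fun _ _ => bot_le) _
      · refine (hfh (fun i => Fin.cons (t i) (y i)) (fun i j => ?_)).trans (le_of_eq ?_)
        · refine Fin.cases ?_ (fun j => ?_) j
          · exact ht i
          · exact hy i j
        · congr 1
          ext j
          refine Fin.cases ?_ (fun j => ?_) j <;> simp

end PrekopaLeindler

/-! ### A Hölder inequality for geometric means. -/

section MeanInequalities

/-- Normalised Hölder inequality: AM-GM in each term, then exchange of the sums. -/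
theorem Finset.sum_prod_rpow_inv_card_le_one {ι κ : Type*} [Fintype ι] [Nonempty ι] (s : Finset κ)
    {c : ι → κ → ℝ} (hc : ∀ r k, 0 ≤ c r k) (hc1 : ∀ r, ∑ k ∈ s, c r k ≤ 1) :
    ∑ k ∈ s, ∏ r, c r k ^ (Fintype.card ι : ℝ)⁻¹ ≤ 1 := by
  have hN : (0 : ℝ) < Fintype.card ι := by exact_mod_cast Fintype.card_pos
  calc ∑ k ∈ s, ∏ r, c r k ^ (Fintype.card ι : ℝ)⁻¹
      ≤ ∑ k ∈ s, ∑ r, (Fintype.card ι : ℝ)⁻¹ * c r k :=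
        Finset.sum_le_sum fun k _ => Real.geom_mean_le_arith_mean_weighted _ _ _
          (fun _ _ => by positivity) (by simp [hN.ne']) fun r _ => hc r k
    _ = ∑ r, (Fintype.card ι : ℝ)⁻¹ * ∑ k ∈ s, c r k := by
        rw [Finset.sum_comm]
        simp_rw [Finset.mul_sum]
    _ ≤ ∑ _r : ι, (Fintype.card ι : ℝ)⁻¹ * 1 := by
        gcongr with r
        exact hc1 r
    _ = 1 := by simp [hN.ne']

end MeanInequalities

/-! ### Volumes of polytopes and counts of lattice points. -/

section Volume

open MeasureTheory Set

theorem lintegral_Icc_sub_mul_pow {c b P : ℝ} (hc : 0 < c) (hb : 0 ≤ b) (hP : 0 < P) (d : ℕ) :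
    ∫⁻ g in Icc 0 (b / c), ENNReal.ofReal ((b - c * g) ^ d / P) =
      ENNReal.ofReal (b ^ (d + 1) / ((d + 1) * (P * c))) := by
  have hbc : 0 ≤ b / c := by positivity
  rw [← ofReal_integral_eq_lintegral_ofReal]
  · congr 1
    rw [integral_Icc_eq_integral_Ioc, ← intervalIntegral.integral_of_le hbc]
    rw [intervalIntegral.integral_eq_sub_of_hasDerivAt
      (f := fun g => -((b - c * g) ^ (d + 1) / ((d + 1) * (P * c))))]
    · have : b - c * (b / c) = 0 := by field_simp; ring
      rw [this]
      simp
    · intro g _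
      have h1 : HasDerivAt (fun g : ℝ => b - c * g) (-c) g := by
        simpa using ((hasDerivAt_id g).const_mul c).const_sub b
      have h2 := ((h1.pow (d + 1)).div_const ((d + 1) * (P * c))).neg
      refine h2.congr_deriv ?_
      push_cast
      field_simp
    · exact (by fun_prop : Continuous fun g : ℝ => (b - c * g) ^ d / P).intervalIntegrable _ _
  · exact (by fun_prop : Continuous fun g : ℝ => (b - c * g) ^ d / P).continuousOn.integrableOn_Icc
  · refine (ae_restrict_iff' measurableSet_Icc).2 (Filter.Eventually.of_forall fun g hg => ?_)
    have : 0 ≤ b - c * g := by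
      have := (le_div_iff₀ hc).1 hg.2
      linarith
    simp only [Pi.zero_apply]
    positivity

/-- Cut by which coordinate is smallest. In dimension d + 1, subtracting the minimum g from the
other d coordinates gives the same polytope in dimension d with b replaced by b - (m+d)g.
Integrating over g yields the factor 1/((d+1)(m+d)), and the d + 1 pieces cancel d + 1. -/
theorem volume_symmetric_polytope_le {m : ℝ} (hm : 1 ≤ m) (d : ℕ) {b : ℝ} (hb : 0 ≤ b) :
    volume {x : Fin d → ℝ | ∀ i, 0 ≤ x i ∧ (m - 1) * x i + ∑ k, x k ≤ b} ≤
      ENNReal.ofReal (b ^ d / ∏ j ∈ Finset.range d, (m + j)) := by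
  induction d generalizing b with
  | zero =>
    rw [volume_pi, Measure.pi_of_empty _ 0]
    simp
  | succ d ih =>
    set P : ℝ := ∏ j ∈ Finset.range d, (m + j) with hP
    have hP0 : 0 < P := Finset.prod_pos fun j _ => by positivity
    have hmd : 0 < m + d := by positivity
    set R : Set (Fin (d + 1) → ℝ) := {x | ∀ i, 0 ≤ x i ∧ (m - 1) * x i + ∑ k, x k ≤ b} with hR
    set A : Fin (d + 1) → Set (Fin (d + 1) → ℝ) := fun i => R ∩ {x | ∀ k, x i ≤ x k} with hA
    have hRm : MeasurableSet R := by
      simp only [hR, ofPred_forall, ofPred_and]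
      exact MeasurableSet.iInter fun i => (measurableSet_le (by fun_prop) (by fun_prop)).inter
        (measurableSet_le (by fun_prop) (by fun_prop))
    have hAm : ∀ i, MeasurableSet (A i) := fun i => by
      refine hRm.inter ?_
      simp only [ofPred_forall]
      exact MeasurableSet.iInter fun k => measurableSet_le (by fun_prop) (by fun_prop)
    have hRA : R ⊆ ⋃ i, A i := fun x hx => by
      obtain ⟨i, -, hi⟩ := Finset.exists_min_image Finset.univ x Finset.univ_nonempty
      exact mem_iUnion.2 ⟨i, hx, fun k => hi k (Finset.mem_univ k)⟩
    have hAvol : ∀ i, volume (A i) ≤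
        ENNReal.ofReal (b ^ (d + 1) / ((d + 1) * (P * (m + d)))) := fun i => by
      have hmp := (volume_preserving_piFinSuccAbove (fun _ : Fin (d + 1) => ℝ) i).symm
      rw [← hmp.measure_preimage (hAm i).nullMeasurableSet, Measure.volume_eq_prod,
        Measure.prod_apply (hmp.measurable (hAm i)), ← lintegral_Icc_sub_mul_pow hmd hb hP0,
        ← lintegral_indicator measurableSet_Icc]
      refine lintegral_mono fun g => ?_
      have hsec : ∀ y : Fin d → ℝ, y ∈ Prod.mk g ⁻¹'
          ((MeasurableEquiv.piFinSuccAbove (fun _ : Fin (d + 1) => ℝ) i).symm ⁻¹' A i) →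
          (0 ≤ g ∧ (m - 1) * g + (g + ∑ k, y k) ≤ b) ∧
            ∀ j, g ≤ y j ∧ (m - 1) * y j + (g + ∑ k, y k) ≤ b := by
        intro y hy
        have hy' : (Fin.insertNth (α := fun _ => ℝ) i g y) ∈ A i := hy
        obtain ⟨h1, h2⟩ := hy'
        have hsum : ∑ k, Fin.insertNth (α := fun _ => ℝ) i g y k = g + ∑ k, y k := by
          rw [Fin.sum_univ_succAbove _ i]
          simp
        refine ⟨?_, fun j => ⟨?_, ?_⟩⟩
        · have := h1 i
          rwa [hsum, Fin.insertNth_apply_same] at this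
        · have := h2 (i.succAbove j)
          rwa [Fin.insertNth_apply_same, Fin.insertNth_apply_succAbove] at this
        · have := (h1 (i.succAbove j)).2
          rwa [hsum, Fin.insertNth_apply_succAbove] at this
      by_cases hg : g ∈ Icc 0 (b / (m + d))
      · rw [indicator_of_mem hg]
        have hb' : 0 ≤ b - (m + d) * g := by
          have := (le_div_iff₀ hmd).1 hg.2
          linarith
        refine le_trans ?_ (ih hb')
        rw [← measure_preimage_add_right volume (fun _ => -g)
          {x : Fin d → ℝ | ∀ i, 0 ≤ x i ∧ (m - 1) * x i + ∑ k, x k ≤ b - (m + d) * g}]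
        refine measure_mono fun y hy j => ?_
        obtain ⟨h1, h2⟩ := hsec y hy
        have h3 := h2 j
        have hsum : ∑ k : Fin d, (y k + -g) = ∑ k, y k - d * g := by
          simp [Finset.sum_add_distrib, sub_eq_add_neg]
        simp only [Pi.add_apply, hsum]
        constructor
        · linarith [h3.1]
        · linarith [h3.2]
      · rw [indicator_of_notMem hg, nonpos_iff_eq_zero]
        refine measure_mono_null (t := ∅) (fun y hy => hg ?_) measure_empty
        obtain ⟨h1, h2⟩ := hsec y hy
        have hle : (d : ℝ) * g ≤ ∑ k, y k := by
          calc (d : ℝ) * g = ∑ _k : Fin d, g := by simp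
            _ ≤ _ := Finset.sum_le_sum fun k _ => (h2 k).1
        refine ⟨h1.1, (le_div_iff₀ hmd).2 ?_⟩
        linarith [h1.2]
    calc volume R ≤ volume (⋃ i, A i) := measure_mono hRA
      _ ≤ ∑ i, volume (A i) := measure_iUnion_fintype_le _ _
      _ ≤ ∑ _i : Fin (d + 1), ENNReal.ofReal (b ^ (d + 1) / ((d + 1) * (P * (m + d)))) :=
        Finset.sum_le_sum fun i _ => hAvol i
      _ = ENNReal.ofReal (b ^ (d + 1) / ∏ j ∈ Finset.range (d + 1), (m + j)) := by
        rw [Finset.sum_const, Finset.card_univ, Fintype.card_fin, nsmul_eq_mul,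
          ← ENNReal.ofReal_natCast, ← ENNReal.ofReal_mul (by positivity), Finset.prod_range_succ,
          ← hP]
        congr 1
        push_cast
        field_simp


/-- The d cyclic rotations of the polytope have equal volume. Coordinatewise geometric means of
points taken one from each rotation lie in the symmetric polytope whose parameters are the geometric
means of `m` and of `b`, so Prékopa–Leindler bounds the volume by that of the symmetric one. -/
theorem volume_polytope_le {d : ℕ} [NeZero d] {m b : Fin d → ℝ} (hm : ∀ i, 1 ≤ m i)
    (hb : ∀ i, 0 < b i) :
    volume {x : Fin d → ℝ | ∀ i, 0 < x i ∧ (m i - 1) * x i + ∑ k, x k ≤ b i} ≤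
      ENNReal.ofReal ((∏ i, b i) /
        ∏ j ∈ Finset.range d, ((∏ i, m i ^ (d : ℝ)⁻¹) + j)) := by
  have hd : (0 : ℝ) < d := by exact_mod_cast Nat.pos_of_ne_zero (NeZero.ne d)
  have hd' : (0 : ℝ) ≤ (d : ℝ)⁻¹ := by positivity
  have hm0 : ∀ i, 0 < m i := fun i => one_pos.trans_le (hm i)
  set M : ℝ := ∏ i, m i ^ (d : ℝ)⁻¹ with hM
  set B : ℝ := ∏ i, b i ^ (d : ℝ)⁻¹ with hB
  have hB0 : 0 < B := Finset.prod_pos fun i _ => Real.rpow_pos_of_pos (hb i) _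
  have hM1 : 1 ≤ M := by
    refine Finset.one_le_prod fun i _ => ?_
    exact Real.one_le_rpow (hm i) hd'
  set R : Set (Fin d → ℝ) := {x | ∀ i, 0 < x i ∧ (m i - 1) * x i + ∑ k, x k ≤ b i} with hR
  set T : Set (Fin d → ℝ) := {x | ∀ i, 0 ≤ x i ∧ (M - 1) * x i + ∑ k, x k ≤ B} with hT
  have hRm : MeasurableSet R := by
    simp only [hR, ofPred_forall, ofPred_and]
    exact MeasurableSet.iInter fun i => (measurableSet_lt (by fun_prop) (by fun_prop)).inter
      (measurableSet_le (by fun_prop) (by fun_prop))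
  have hTm : MeasurableSet T := by
    simp only [hT, ofPred_forall, ofPred_and]
    exact MeasurableSet.iInter fun i => (measurableSet_le (by fun_prop) (by fun_prop)).inter
      (measurableSet_le (by fun_prop) (by fun_prop))
  have hsumle : ∀ x ∈ R, ∀ i, x i ≤ ∑ k, b k := fun x hx i => by
    have h1 : (m i - 1) * x i + ∑ k, x k ≤ b i := (hx i).2
    have h2 : x i ≤ ∑ k, x k := Finset.single_le_sum (fun k _ => (hx k).1.le) (Finset.mem_univ i)
    have h3 : b i ≤ ∑ k, b k := Finset.single_le_sum (fun k _ => (hb k).le) (Finset.mem_univ i)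
    have h4 : 0 ≤ (m i - 1) * x i := mul_nonneg (sub_nonneg.2 (hm i)) (hx i).1.le
    linarith
  have hrot : ∀ r : Fin d, MeasurePreserving
      (fun (x : Fin d → ℝ) (j : Fin d) => x (j + r)) := fun r =>
    volume_preserving_arrowCongr' (Equiv.subRight r) (MeasurableEquiv.refl ℝ)
      (MeasurePreserving.id _)
  set f : Fin d → (Fin d → ℝ) → ℝ≥0∞ := fun r x =>
    R.indicator (fun _ => 1) (fun j => x (j + r)) with hf
  have hfint : ∀ r, ∫⁻ x, f r x = volume R := fun r => by
    rw [(hrot r).lintegral_comp (measurable_const.indicator hRm),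
      lintegral_indicator_const hRm, one_mul]
  have hPL := prod_lintegral_pi_rpow_le_lintegral_pi (ι := Fin d) (C := 1) ENNReal.one_ne_top
    (B := ∑ k, b k) (f := f) (h := T.indicator fun _ => 1)
    (fun r => (measurable_const.indicator hRm).comp (hrot r).measurable)
    (measurable_const.indicator hTm)
    (by
      intro r x
      by_cases hx : (fun j => x (j + r)) ∈ R
      · refine (indicator_le_self' (fun _ _ => bot_le) _).trans (le_of_eq ?_)
        rw [indicator_of_mem]
        intro j _
        have h1 := (hx (j - r)).1
        have h2 := hsumle _ hx (j - r)
        simp only [sub_add_cancel] at h1 h2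
        exact ⟨h1, h2⟩
      · simp only [hf, indicator_of_notMem hx]
        exact bot_le)
    (by
      intro x hx
      by_cases hall : ∀ r, (fun j => x r (j + r)) ∈ R
      · have hmem : (fun j => ∏ r, x r j ^ ((Fintype.card (Fin d) : ℕ) : ℝ)⁻¹) ∈ T := by
          have hz0 : ∀ j, 0 ≤ ∏ r, x r j ^ ((Fintype.card (Fin d) : ℕ) : ℝ)⁻¹ := fun j =>
            Finset.prod_nonneg fun r _ => Real.rpow_nonneg (hx r j).le _
          refine fun j => ⟨hz0 j, ?_⟩
          -- Rotation r supplies its constraint with index j - r, which concerns coordinate j. As r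
          -- varies, j - r runs through all indices, so the products of `m (j - r)` and `b (j - r)`
          -- assemble to `M` and `B`.
          have hc := Finset.sum_prod_rpow_inv_card_le_one (ι := Fin d) Finset.univ
            (c := fun r k => (if k = j then m (j - r) else 1) * x r k / b (j - r))
            (fun r k => by
              have := hx r k
              have := hb (j - r)
              have := hm0 (j - r)
              split_ifs <;> positivity)
            (fun r => by
              have h1 := (hall r (j - r)).2
              simp only [sub_add_cancel] at h1
              have h2 : ∑ k, x r (k + r) = ∑ k, x r k :=
                Equiv.sum_comp (Equiv.addRight r) (x r)
              rw [h2] at h1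
              rw [← Finset.sum_div, div_le_one (hb _)]
              refine le_trans (le_of_eq ?_) h1
              have : ∀ k, (if k = j then m (j - r) else 1) * x r k =
                  (if k = j then (m (j - r) - 1) * x r k else 0) + x r k := fun k => by
                split_ifs <;> ring
              simp_rw [this]
              rw [Finset.sum_add_distrib, Finset.sum_ite_eq' Finset.univ j]
              simp)
          have hsplit : ∀ k, ∏ r, ((if k = j then m (j - r) else 1) * x r k / b (j - r)) ^
              ((Fintype.card (Fin d) : ℕ) : ℝ)⁻¹ =
              ((if k = j then M else 1) *
                ∏ r, x r k ^ ((Fintype.card (Fin d) : ℕ) : ℝ)⁻¹) / B := fun k => by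
            have hBj : B = ∏ r, b (j - r) ^ (d : ℝ)⁻¹ :=
              (Equiv.prod_comp (Equiv.subLeft j) fun i => b i ^ (d : ℝ)⁻¹).symm
            have hMj : M = ∏ r, m (j - r) ^ (d : ℝ)⁻¹ :=
              (Equiv.prod_comp (Equiv.subLeft j) fun i => m i ^ (d : ℝ)⁻¹).symm
            have hite : (if k = j then M else 1) =
                ∏ r, (if k = j then m (j - r) else 1) ^ (d : ℝ)⁻¹ := by
              split_ifs
              · exact hMj
              · simp
            rw [hite, hBj, Fintype.card_fin, ← Finset.prod_mul_distrib, ← Finset.prod_div_distrib]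
            refine Finset.prod_congr rfl fun r _ => ?_
            have h1 : (0 : ℝ) ≤ if k = j then m (j - r) else 1 := by
              have := hm0 (j - r)
              split_ifs <;> positivity
            rw [Real.div_rpow (mul_nonneg h1 (hx r k).le) (hb _).le,
              Real.mul_rpow h1 (hx r k).le]
          simp_rw [hsplit] at hc
          rw [← Finset.sum_div, div_le_one hB0] at hc
          refine le_trans (le_of_eq ?_) hc
          have : ∀ k, (if k = j then M else 1) *
                ∏ r, x r k ^ ((Fintype.card (Fin d) : ℕ) : ℝ)⁻¹ =
              (if k = j then (M - 1) * ∏ r, x r k ^ ((Fintype.card (Fin d) : ℕ) : ℝ)⁻¹ else 0) +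
                ∏ r, x r k ^ ((Fintype.card (Fin d) : ℕ) : ℝ)⁻¹ := fun k => by
            split_ifs <;> ring
          simp_rw [this]
          rw [Finset.sum_add_distrib, Finset.sum_ite_eq' Finset.univ j]
          simp
        rw [indicator_of_mem hmem]
        refine Finset.prod_le_one' fun r _ => ?_
        exact ENNReal.rpow_le_one (indicator_le_self' (fun _ _ => bot_le) _) (by positivity)
      · push Not at hall
        obtain ⟨r, hr⟩ := hall
        refine le_of_eq_of_le (Finset.prod_eq_zero (Finset.mem_univ r) ?_) bot_le
        simp only [hf, indicator_of_notMem hr]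
        exact ENNReal.zero_rpow_of_pos (by simpa using hd))
  simp_rw [hfint] at hPL
  rw [ENNReal.prod_rpow_inv_card_const, lintegral_indicator_const hTm, one_mul] at hPL
  refine (hPL.trans (volume_symmetric_polytope_le hM1 d hB0.le)).trans (le_of_eq ?_)
  congr 2
  rw [hB, ← Finset.prod_pow]
  refine Finset.prod_congr rfl fun i _ => ?_
  rw [← Real.rpow_natCast, ← Real.rpow_mul (hb i).le, inv_mul_cancel₀ hd.ne', Real.rpow_one]

/-- Unit cubes attached to lattice points bound the number of lattice points by a volume. -/
theorem card_le_volume_of_cubes {d : ℕ} (s : Finset (Fin d → ℕ)) {R : Set (Fin d → ℝ)}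
    (h : ∀ γ ∈ s, ∀ x : Fin d → ℝ, (∀ i, (γ i : ℝ) < x i ∧ x i ≤ γ i + 1) → x ∈ R) :
    (s.card : ℝ≥0∞) ≤ volume R := by
  set Q : (Fin d → ℕ) → Set (Fin d → ℝ) := fun γ =>
    pi univ fun i => Ioc (γ i : ℝ) (γ i + 1) with hQ
  have hvol : ∀ γ, volume (Q γ) = 1 := fun γ => by
    rw [Real.volume_pi_Ioc]
    simp
  calc (s.card : ℝ≥0∞) = ∑ γ ∈ s, volume (Q γ) := by simp [hvol]
    _ = volume (⋃ γ ∈ s, Q γ) := by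
      refine (measure_biUnion_finset (fun γ _ δ _ hne => ?_) fun γ _ =>
        MeasurableSet.univ_pi fun _ => measurableSet_Ioc).symm
      refine Set.disjoint_left.2 fun x hx hx' => hne ?_
      funext i
      have h1 := hx i trivial
      have h2 := hx' i trivial
      have h3 : (γ i : ℝ) < δ i + 1 := h1.1.trans_le h2.2
      have h4 : (δ i : ℝ) < γ i + 1 := h2.1.trans_le h1.2
      norm_cast at h3 h4
      omega
    _ ≤ volume R := measure_mono (iUnion₂_subset fun γ hγ x hx => h γ hγ x fun i => hx i trivial)

/-- The constraints are monotone because m ≥ 1, so checking them at the far corner γ + 1 puts the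
whole unit cube at γ inside the polytope. -/
theorem card_lattice_points_le {d : ℕ} [NeZero d] {m b : Fin d → ℝ} (hm : ∀ i, 1 ≤ m i)
    (hb : ∀ i, 0 < b i) (s : Finset (Fin d → ℕ))
    (hs : ∀ γ ∈ s, ∀ i, (m i - 1) * (γ i + 1) + ∑ k, ((γ k : ℝ) + 1) ≤ b i) :
    (s.card : ℝ) ≤ (∏ i, b i) / ∏ j ∈ Finset.range d, ((∏ i, m i ^ (d : ℝ)⁻¹) + j) := by
  have h := (card_le_volume_of_cubes s
    (R := {x | ∀ i, 0 < x i ∧ (m i - 1) * x i + ∑ k, x k ≤ b i}) fun γ hγ x hx i => by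
    refine ⟨(Nat.cast_nonneg _).trans_lt (hx i).1, le_trans ?_ (hs γ hγ i)⟩
    have h1 : ∑ k, x k ≤ ∑ k, ((γ k : ℝ) + 1) := Finset.sum_le_sum fun k _ => (hx k).2
    have h2 : (m i - 1) * x i ≤ (m i - 1) * (γ i + 1) :=
      mul_le_mul_of_nonneg_left (hx i).2 (sub_nonneg.2 (hm i))
    linarith).trans (volume_polytope_le hm hb)
  have hnonneg : 0 ≤ (∏ i, b i) / ∏ j ∈ Finset.range d, ((∏ i, m i ^ (d : ℝ)⁻¹) + j) := by
    refine div_nonneg (Finset.prod_nonneg fun i _ => (hb i).le)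
      (Finset.prod_nonneg fun j _ => add_nonneg (Finset.prod_nonneg fun i _ =>
        Real.rpow_nonneg (zero_le_one.trans (hm i)) _) (Nat.cast_nonneg j))
  rw [← ENNReal.ofReal_natCast] at h
  exact (ENNReal.ofReal_le_ofReal_iff hnonneg).1 h

end Volume

/-! ### Taylor coefficients in a basis of directions, over any field. -/

section TaylorExpansion

open MvPolynomial

variable {F : Type*} [Field F] {d : ℕ}

/-- Substitution of `q + ∑ k, X k • w k` for the variables. -/
noncomputable def taylorAt (q : Fin d → F) (w : Fin d → Fin d → F) :
    MvPolynomial (Fin d) F →ₐ[F] MvPolynomial (Fin d) F :=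
  aeval fun j => C (q j) + ∑ k, C (w k j) * X k

/-- The ideal of polynomials vanishing at a point, given by its standard generators. -/
noncomputable def pointIdeal (q : Fin d → F) : Ideal (MvPolynomial (Fin d) F) :=
  Ideal.span (Set.range fun j => X j - C (q j))

/-- The inverse substitution of `taylorAt`. -/
noncomputable def taylorInv (q : Fin d → F) (w : Fin d → Fin d → F) :
    MvPolynomial (Fin d) F →ₐ[F] MvPolynomial (Fin d) F :=
  aeval fun k => ∑ l, C ((Matrix.of w)⁻¹ l k) * (X l - C (q l))

theorem taylorInv_taylorAt (q : Fin d → F) {w : Fin d → Fin d → F} (hw : LinearIndependent F w)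
    (f : MvPolynomial (Fin d) F) : taylorInv q w (taylorAt q w f) = f := by
  have hunit : IsUnit (Matrix.of w) := Matrix.linearIndependent_rows_iff_isUnit.1 hw
  have hinv : (Matrix.of w)⁻¹ * Matrix.of w = 1 :=
    Matrix.nonsing_inv_mul _ ((Matrix.isUnit_iff_isUnit_det _).1 hunit)
  have h : (taylorInv q w).comp (taylorAt q w) = AlgHom.id F _ := by
    refine MvPolynomial.algHom_ext fun j => ?_
    simp only [AlgHom.comp_apply, taylorAt, aeval_X, map_add, map_sum, map_mul, AlgHom.id_apply]
    have hC : ∀ c : F, taylorInv q w (C c) = C c := fun c => (taylorInv q w).commutes c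
    have hX : ∀ k, taylorInv q w (X k) = ∑ l, C ((Matrix.of w)⁻¹ l k) * (X l - C (q l)) :=
      fun k => aeval_X _ _
    simp_rw [hC, hX, Finset.mul_sum]
    rw [Finset.sum_comm]
    have hl : ∀ l, ∑ k, C (w k j) * (C ((Matrix.of w)⁻¹ l k) * (X l - C (q l))) =
        C ((1 : Matrix (Fin d) (Fin d) F) l j) * (X l - C (q l)) := fun l => by
      rw [← hinv, Matrix.mul_apply, map_sum, Finset.sum_mul]
      refine Finset.sum_congr rfl fun k _ => ?_
      rw [map_mul, Matrix.of_apply]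
      ring
    simp_rw [hl, Matrix.one_apply]
    simp
  exact DFunLike.congr_fun h f

theorem taylorAt_injective (q : Fin d → F) {w : Fin d → Fin d → F} (hw : LinearIndependent F w) :
    Function.Injective (taylorAt q w) :=
  Function.LeftInverse.injective (taylorInv_taylorAt q hw)

/-- The inverse substitution sends each variable into `pointIdeal q`, hence a monomial of degree at
least N into its N-th power. The conclusion no longer mentions the basis `w`, so orders of vanishing
can be compared between joints. -/
theorem mem_pointIdeal_pow_of_coeff_eq_zero (q : Fin d → F) {w : Fin d → Fin d → F}
    (hw : LinearIndependent F w) {f : MvPolynomial (Fin d) F} {N : ℕ}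
    (h : ∀ e : Fin d →₀ ℕ, e.degree < N → coeff e (taylorAt q w f) = 0) :
    f ∈ pointIdeal q ^ N := by
  rw [← taylorInv_taylorAt q hw f, (taylorAt q w f).as_sum, map_sum]
  refine Ideal.sum_mem _ fun e he => ?_
  have hN : N ≤ e.degree := by
    by_contra hlt
    exact (mem_support_iff.1 he) (h e (not_le.1 hlt))
  refine Ideal.pow_le_pow_right hN ?_
  rw [taylorInv, aeval_monomial]
  refine Ideal.mul_mem_left _ _ ?_
  rw [Finsupp.prod, Finsupp.degree_apply, ← Finset.prod_pow_eq_pow_sum]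
  refine Ideal.prod_mem_prod fun k _ => Ideal.pow_mem_pow ?_ _
  exact Ideal.sum_mem _ fun l _ => Ideal.mul_mem_left _ _ (Ideal.subset_span ⟨l, rfl⟩)

theorem coeff_taylorAt_eq_zero (q : Fin d → F) (w : Fin d → Fin d → F)
    {f : MvPolynomial (Fin d) F} {e : Fin d →₀ ℕ} (he : f.totalDegree < e.degree) :
    coeff e (taylorAt q w f) = 0 := by
  refine coeff_eq_zero_of_totalDegree_lt ?_
  refine lt_of_le_of_lt ?_ he
  rw [f.as_sum, map_sum]
  refine totalDegree_finsetSum_le fun a ha => ?_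
  rw [← f.as_sum, taylorAt, aeval_monomial]
  refine (totalDegree_mul _ _).trans ?_
  have h1 : (algebraMap F (MvPolynomial (Fin d) F) (coeff a f)).totalDegree = 0 :=
    totalDegree_C _
  rw [h1, zero_add, Finsupp.prod]
  refine (totalDegree_finsetProd _ _).trans ?_
  refine le_trans (Finset.sum_le_sum fun j _ => ?_) (le_totalDegree ha)
  refine (totalDegree_pow _ _).trans ?_
  have hj : (C (q j) + ∑ k, C (w k j) * X k : MvPolynomial (Fin d) F).totalDegree ≤ 1 := by
    refine (totalDegree_add _ _).trans (max_le (by simp) ?_)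
    refine totalDegree_finsetSum_le fun k _ => (totalDegree_mul _ _).trans ?_
    simp [totalDegree_X]
  simpa using Nat.mul_le_mul_left (a j) hj

/-- Polynomials over `F[X]` whose coefficients at `δ` are divisible by `(X - t) ^ (N - |δ|)`. -/
noncomputable def lineIdeal (d : ℕ) (t : F) (N : ℕ) : Ideal (MvPolynomial (Fin d) (Polynomial F)) where
  carrier := {P | ∀ δ : Fin d →₀ ℕ, (Polynomial.X - Polynomial.C t) ^ (N - δ.degree) ∣ coeff δ P}
  add_mem' := fun hP hQ δ => by
    rw [coeff_add]
    exact dvd_add (hP δ) (hQ δ)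
  zero_mem' := fun δ => by simp
  smul_mem' := fun P Q hQ δ => by
    rw [smul_eq_mul, coeff_mul]
    refine Finset.dvd_sum fun x hx => Dvd.dvd.mul_left ((pow_dvd_pow _ ?_).trans (hQ x.2)) _
    rw [← Finset.HasAntidiagonal.mem_antidiagonal.1 hx, map_add]
    omega

theorem mul_mem_lineIdeal {t : F} {M N : ℕ} {P Q : MvPolynomial (Fin d) (Polynomial F)}
    (hP : P ∈ lineIdeal d t M) (hQ : Q ∈ lineIdeal d t N) : P * Q ∈ lineIdeal d t (M + N) := by
  intro δ
  rw [coeff_mul]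
  refine Finset.dvd_sum fun x hx => ?_
  refine dvd_trans ?_ (mul_dvd_mul (hP x.1) (hQ x.2))
  rw [← pow_add]
  refine pow_dvd_pow _ ?_
  rw [← Finset.HasAntidiagonal.mem_antidiagonal.1 hx, map_add]
  omega

/-- Turns the variable `X i` into the variable of the coefficient ring `F[X]`. -/
noncomputable def separateVar (i : Fin d) :
    MvPolynomial (Fin d) F →ₐ[F] MvPolynomial (Fin d) (Polynomial F) :=
  aeval fun k => if k = i then C Polynomial.X else X k

theorem separateVar_monomial (i : Fin d) (e : Fin d →₀ ℕ) (c : F) :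
    separateVar i (monomial e c) = monomial (e.erase i) (Polynomial.monomial (e i) c) := by
  have h1 : separateVar i (monomial (e.erase i) (1 : F)) = monomial (e.erase i) 1 := by
    rw [separateVar, aeval_monomial, map_one, one_mul, monomial_eq, C_1, one_mul]
    refine Finsupp.prod_congr fun k hk => ?_
    rw [if_neg]
    rintro rfl
    simp at hk
  have h2 : (monomial e c : MvPolynomial (Fin d) F) =
      C c * X i ^ e i * monomial (e.erase i) 1 := by
    rw [X_pow_eq_monomial, C_mul_monomial, monomial_mul, mul_one, mul_one,
      Finsupp.single_add_erase]
  rw [h2, map_mul, map_mul, map_pow, h1]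
  have h3 : separateVar i (C c : MvPolynomial (Fin d) F) = C (Polynomial.C c) :=
    (separateVar i).commutes c
  have h4 : separateVar i (X i : MvPolynomial (Fin d) F) = C Polynomial.X := by
    simp [separateVar]
  rw [h3, h4, ← map_pow, ← map_mul, C_mul_monomial, mul_one, Polynomial.C_mul_X_pow_eq_monomial]

theorem coeff_coeff_separateVar (i : Fin d) (e : Fin d →₀ ℕ) (k : ℕ)
    (g : MvPolynomial (Fin d) F) :
    (coeff (e.erase i) (separateVar i g)).coeff k = coeff (e.erase i + Finsupp.single i k) g := by
  classical
  induction g using MvPolynomial.induction_on' with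
  | monomial a c =>
    rw [separateVar_monomial, coeff_monomial, coeff_monomial]
    by_cases h : a = e.erase i + Finsupp.single i k
    · subst h
      rw [if_pos rfl, if_pos]
      · simp
      · ext j
        by_cases hj : j = i
        · subst hj; simp
        · simp [hj]
    · rw [if_neg h]
      split_ifs with h'
      · rw [Polynomial.coeff_monomial, if_neg]
        rintro rfl
        exact h (by rw [← h', Finsupp.erase_add_single])
      · simp
  | add p q hp hq => simp [hp, hq]

/-- In coordinates at p, a generator of the ideal at p + t v_i becomes a combination of X - t and
the transverse variables, so it lies in `lineIdeal d t 1`; these ideals are multiplicative in their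
order. -/
theorem pointIdeal_pow_le_comap (p : Fin d → F) (v : Fin d → Fin d → F) (i : Fin d) (t : F)
    (N : ℕ) : pointIdeal (p + t • v i) ^ N ≤
      (lineIdeal d t N).comap ((separateVar i).comp (taylorAt p v)) := by
  have h1 : pointIdeal (p + t • v i) ≤
      (lineIdeal d t 1).comap ((separateVar i).comp (taylorAt p v)) := by
    refine Ideal.span_le.2 ?_
    rintro _ ⟨j, rfl⟩
    rw [SetLike.mem_coe, Ideal.mem_comap]
    have hC : ∀ c : F, separateVar i (C c : MvPolynomial (Fin d) F) = C (Polynomial.C c) :=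
      fun c => (separateVar i).commutes c
    have e : ((separateVar i).comp (taylorAt p v)) (X j - C ((p + t • v i) j)) =
        ∑ k, C (Polynomial.C (v k j)) *
          (if k = i then C (Polynomial.X - Polynomial.C t) else X k) := by
      have hCt : taylorAt p v (C ((p + t • v i) j)) = C ((p + t • v i) j) :=
        (taylorAt p v).commutes _
      have hX : taylorAt p v (X j) = C (p j) + ∑ k, C (v k j) * X k := aeval_X _ _
      have hXk : ∀ k, separateVar i (X k : MvPolynomial (Fin d) F) =
          if k = i then C Polynomial.X else X k := fun k => aeval_X _ _
      rw [AlgHom.comp_apply, map_sub, hCt, hX, map_sub, map_add, map_sum, hC, hC]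
      simp_rw [map_mul, hC, hXk]
      have hsplit : ∀ k, C (Polynomial.C (v k j)) *
          (if k = i then C (Polynomial.X - Polynomial.C t) else X k) =
          C (Polynomial.C (v k j)) * (if k = i then C Polynomial.X else X k) -
            (if k = i then C (Polynomial.C (v k j) * Polynomial.C t) else
              (0 : MvPolynomial (Fin d) (Polynomial F))) := fun k => by
        split_ifs
        · rw [map_sub, map_mul]; ring
        · ring
      simp_rw [hsplit, Finset.sum_sub_distrib]
      rw [Finset.sum_ite_eq' Finset.univ i]
      simp only [Finset.mem_univ, if_true, Pi.add_apply, Pi.smul_apply, smul_eq_mul, map_add,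
        map_mul]
      ring
    rw [e]
    refine Ideal.sum_mem _ fun k _ => Ideal.mul_mem_left _ _ ?_
    intro δ
    split_ifs
    · rw [coeff_C]
      split_ifs with h0
      · rw [← h0]; simp
      · simp
    · rcases Nat.eq_zero_or_pos δ.degree with h0 | h0
      · rw [Finsupp.degree_eq_zero_iff] at h0
        rw [h0]
        simp
      · have : 1 - δ.degree = 0 := by omega
        simp [this]
  induction N with
  | zero => intro f _ δ; simp
  | succ N ih =>
    rw [pow_succ, Ideal.mul_le]
    intro f hf g hg
    rw [Ideal.mem_comap, map_mul]
    exact mul_mem_lineIdeal (ih hf) (h1 hg)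

/-- A polynomial of degree at most `n` with too many zeros on the line through `p` in direction
`v i` has vanishing Taylor coefficients at `p`. -/
theorem coeff_taylorAt_eq_zero_of_mem_pointIdeal {κ : Type*} (s : Finset κ) {t : κ → F}
    (ht : Set.InjOn t s) {N : κ → ℕ} (p : Fin d → F) (v : Fin d → Fin d → F) (i : Fin d)
    {f : MvPolynomial (Fin d) F} (hf : ∀ q ∈ s, f ∈ pointIdeal (p + t q • v i) ^ N q)
    (e : Fin d →₀ ℕ)
    (hn : f.totalDegree < ∑ q ∈ s, (N q - (e.erase i).degree) + (e.erase i).degree) :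
    coeff e (taylorAt p v f) = 0 := by
  set G := coeff (e.erase i) (separateVar i (taylorAt p v f)) with hG
  have hcoeff : ∀ k, G.coeff k = coeff (e.erase i + Finsupp.single i k) (taylorAt p v f) :=
    fun k => coeff_coeff_separateVar i e k _
  suffices G = 0 by
    have h := hcoeff (e i)
    rw [this, Finsupp.erase_add_single] at h
    simpa using h.symm
  by_contra hG0
  -- `G` is a polynomial in the parameter along the line. Fixing the transverse exponent `e.erase i`
  -- costs its degree both in the order of each zero and in the degree of `G`.
  have hdvd : ∏ q ∈ s, (Polynomial.X - Polynomial.C (t q)) ^ (N q - (e.erase i).degree) ∣ G := by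
    refine Finset.prod_dvd_of_coprime (fun a ha b hb hab => ?_) fun q hq => ?_
    · exact IsCoprime.pow (Polynomial.isCoprime_X_sub_C_of_isUnit_sub
        (sub_ne_zero.2 fun h => hab (ht ha hb h)).isUnit)
    · exact pointIdeal_pow_le_comap p v i (t q) (N q) (hf q hq) (e.erase i)
  have hdeg := Polynomial.natDegree_le_of_dvd hdvd hG0
  rw [Polynomial.natDegree_prod_of_monic _ _ fun q _ => (Polynomial.monic_X_sub_C _).pow _] at hdeg
  simp only [Polynomial.natDegree_pow, Polynomial.natDegree_X_sub_C, mul_one] at hdeg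
  have hlead : G.coeff G.natDegree ≠ 0 := by simpa using hG0
  refine hlead ?_
  rw [hcoeff]
  refine coeff_taylorAt_eq_zero _ _ ?_
  rw [map_add, Finsupp.degree_single]
  omega

end TaylorExpansion

/-! ### Vanishing lemma with handicaps, and the resulting dimension count. -/

section VanishingLemma

open MvPolynomial

/-- Coordinate 0 of the d + 1 exponents is a slack variable making the total degree exactly n. -/
theorem choose_le_finrank_restrictTotalDegree (F : Type*) [Field F] (d n : ℕ) :
    (d + n).choose n ≤ Module.finrank F (restrictTotalDegree (Fin d) F n) := by
  classical
  have hcard := Finset.card_finsuppAntidiag_nat_eq_choose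
    (s := (Finset.univ : Finset (Fin (d + 1)))) n
  rw [Finset.card_univ, Fintype.card_fin, show d + 1 + n - 1 = d + n by omega] at hcard
  set A := (Finset.univ : Finset (Fin (d + 1))).finsuppAntidiag n with hA
  have hsum : ∀ s ∈ A, s 0 + ∑ i, Finsupp.tail s i = n := fun s hs => by
    rw [← (Finset.mem_finsuppAntidiag.1 hs).1, Fin.sum_univ_succ]
    rfl
  have hinj : Function.Injective fun s : A => Finsupp.tail s.1 := fun s t hst => by
    have hst' : Finsupp.tail s.1 = Finsupp.tail t.1 := hst
    have h1 := hsum s.1 s.2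
    have h2 := hsum t.1 t.2
    rw [hst'] at h1
    refine Subtype.ext ?_
    rw [← Finsupp.cons_tail s.1, ← Finsupp.cons_tail t.1, hst']
    congr 1
    omega
  have hmem : ∀ s : A, monomial (Finsupp.tail s.1) (1 : F) ∈ restrictTotalDegree (Fin d) F n :=
    fun s => by
      rw [mem_restrictTotalDegree, totalDegree_monomial _ one_ne_zero,
        Finsupp.sum_fintype _ _ fun _ => rfl]
      have := hsum s.1 s.2
      omega
  have hind : LinearIndependent F fun s : A =>
      (⟨monomial (Finsupp.tail s.1) (1 : F), hmem s⟩ : restrictTotalDegree (Fin d) F n) := by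
    refine LinearIndependent.of_comp (restrictTotalDegree (Fin d) F n).subtype ?_
    exact (basisMonomials (Fin d) F).linearIndependent.comp _ hinj
  have := hind.fintype_card_le_finrank
  rwa [Fintype.card_coe, hcard] at this

variable {F : Type*} [Field F] {d : ℕ} {P Λ : Type*} [Fintype P]

open Classical in
/-- The points having `l` among their chosen lines. -/
noncomputable def pointsOn (ℓ : P → Fin d → Λ) (l : Λ) : Finset P :=
  Finset.univ.filter fun q => ∃ j, ℓ q j = l

theorem mem_pointsOn {ℓ : P → Fin d → Λ} {l : Λ} {q : P} :
    q ∈ pointsOn ℓ l ↔ ∃ j, ℓ q j = l := by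
  simp [pointsOn]

/-- Vanishing of prescribed Taylor coefficients at joints forces vanishing. -/
theorem eq_zero_of_coeff_taylorAt_eq_zero [Nonempty P] {pt : P → Fin d → F}
    (hpt : Function.Injective pt) {v : P → Fin d → Fin d → F}
    (hv : ∀ p, LinearIndependent F (v p)) {ℓ : P → Fin d → Λ}
    (hℓ : ∀ p i q j, ℓ q j = ℓ p i → ∃ t : F, pt q = pt p + t • v p i) {n : ℕ} (a : P → ℤ)
    {f : MvPolynomial (Fin d) F} (hf : f.totalDegree ≤ n)
    (h : ∀ p (e : Fin d →₀ ℕ), (∀ i, ∑ q ∈ pointsOn ℓ (ℓ p i), ((e i : ℤ) + a p - a q).toNat +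
      (e.erase i).degree ≤ n) → coeff e (taylorAt (pt p) (v p) f) = 0) : f = 0 := by
  obtain ⟨p₀, -, hp₀⟩ := Finset.exists_min_image Finset.univ a Finset.univ_nonempty
  have hmin : ∀ p, a p₀ ≤ a p := fun p => hp₀ p (Finset.mem_univ p)
  -- Induction on the handicapped order |e| + a_p, offset by the least handicap. If e is not among
  -- the prescribed exponents, some line i has too many zeros: by induction f vanishes at each q on
  -- it to order max(|e| + a_p - a_q, 0), which forces the coefficient at e to vanish.
  have key : ∀ T : ℕ, ∀ p (e : Fin d →₀ ℕ), (e.degree : ℤ) + a p - a p₀ < T →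
      coeff e (taylorAt (pt p) (v p) f) = 0 := by
    intro T
    induction T with
    | zero => intro p e he; have := hmin p; push_cast at he; omega
    | succ T ih =>
      intro p e he
      by_cases hgood : ∀ i, ∑ q ∈ pointsOn ℓ (ℓ p i), ((e i : ℤ) + a p - a q).toNat +
        (e.erase i).degree ≤ n
      · exact h p e hgood
      push Not at hgood
      obtain ⟨i, hi⟩ := hgood
      have hdeg : e.degree = e i + (e.erase i).degree := by
        conv_lhs => rw [← Finsupp.single_add_erase i e]
        rw [map_add, Finsupp.degree_single]
      have ht : ∀ q, ∃ t : F, q ∈ pointsOn ℓ (ℓ p i) → pt q = pt p + t • v p i := fun q => by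
        by_cases hq : q ∈ pointsOn ℓ (ℓ p i)
        · obtain ⟨j, hj⟩ := mem_pointsOn.1 hq
          obtain ⟨t, ht⟩ := hℓ p i q j hj
          exact ⟨t, fun _ => ht⟩
        · exact ⟨0, fun hq' => absurd hq' hq⟩
      choose t ht using ht
      refine coeff_taylorAt_eq_zero_of_mem_pointIdeal (pointsOn ℓ (ℓ p i)) (t := t)
        (fun q hq r hr hqr => hpt ?_)
        (N := fun q => ((e.degree : ℤ) + a p - a q).toNat) (pt p) (v p) i (fun q hq => ?_) e ?_
      · rw [ht q hq, ht r hr, hqr]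
      · rw [← ht q hq]
        refine mem_pointIdeal_pow_of_coeff_eq_zero (pt q) (hv q) fun e' he' => ih q e' ?_
        omega
      · refine lt_of_le_of_lt hf (lt_of_lt_of_le hi (le_of_eq ?_))
        congr 1
        refine Finset.sum_congr rfl fun q _ => ?_
        omega
  refine taylorAt_injective (pt p₀) (hv p₀) ?_
  rw [map_zero]
  ext e
  rw [coeff_zero]
  exact key (e.degree + 1) p₀ e (by push_cast; omega)

/-- By the vanishing lemma, the linear map reading off the coefficients indexed by `Γ` is injective
on polynomials of degree at most n. -/
theorem choose_le_sum_card [Nonempty P] {pt : P → Fin d → F}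
    (hpt : Function.Injective pt) {v : P → Fin d → Fin d → F}
    (hv : ∀ p, LinearIndependent F (v p)) {ℓ : P → Fin d → Λ}
    (hℓ : ∀ p i q j, ℓ q j = ℓ p i → ∃ t : F, pt q = pt p + t • v p i) (n : ℕ) (a : P → ℤ)
    (Γ : P → Finset (Fin d → ℕ))
    (hΓ : ∀ p (γ : Fin d → ℕ), (∀ i, ∑ q ∈ pointsOn ℓ (ℓ p i), ((γ i : ℤ) + a p - a q).toNat +
      ∑ k ∈ Finset.univ.erase i, γ k ≤ n) → γ ∈ Γ p) :
    (d + n).choose n ≤ ∑ p, (Γ p).card := by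
  classical
  refine (choose_le_finrank_restrictTotalDegree F d n).trans ?_
  let Φ : restrictTotalDegree (Fin d) F n →ₗ[F] ((Σ p, Γ p) → F) :=
    LinearMap.pi fun x => (MvPolynomial.lcoeff F (Finsupp.equivFunOnFinite.symm x.2.1)) ∘ₗ
      (taylorAt (pt x.1) (v x.1)).toLinearMap ∘ₗ (restrictTotalDegree (Fin d) F n).subtype
  have hΦ : Function.Injective Φ := by
    rw [← LinearMap.ker_eq_bot, LinearMap.ker_eq_bot']
    intro f hf
    refine Subtype.ext (eq_zero_of_coeff_taylorAt_eq_zero hpt hv hℓ (n := n) a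
      ((mem_restrictTotalDegree _ _ _).1 f.2) fun p e he => ?_)
    have hmem : (e : Fin d → ℕ) ∈ Γ p := hΓ p e fun i => by
      have h := he i
      have hdeg : (e.erase i).degree = ∑ k ∈ Finset.univ.erase i, e k := by
        rw [Finsupp.degree_eq_sum, ← Finset.add_sum_erase _ _ (Finset.mem_univ i),
          Finsupp.erase_same, zero_add]
        exact Finset.sum_congr rfl fun k hk => Finsupp.erase_ne (Finset.ne_of_mem_erase hk)
      rwa [hdeg] at h
    have := congrFun hf ⟨p, ⟨e, hmem⟩⟩
    simpa [Φ] using this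
  have := LinearMap.finrank_le_finrank_of_injective hΦ
  rw [Module.finrank_fintype_fun_eq_card, Fintype.card_sigma] at this
  simpa using this

end VanishingLemma

/-! ### The Laplacian whose solutions supply the handicaps. -/

section Laplacian

variable {d : ℕ} {P Λ : Type*} [Fintype P]

theorem self_mem_pointsOn (ℓ : P → Fin d → Λ) (p : P) (i : Fin d) : p ∈ pointsOn ℓ (ℓ p i) :=
  mem_pointsOn.2 ⟨i, rfl⟩

theorem sum_pointsOn_eq [DecidableEq Λ] {ℓ : P → Fin d → Λ} (hℓ : ∀ p, Function.Injective (ℓ p)) (l : Λ)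
    (g : P → ℝ) : ∑ q ∈ pointsOn ℓ l, g q = ∑ q, ∑ j, if ℓ q j = l then g q else 0 := by
  classical
  rw [pointsOn, Finset.sum_filter]
  refine Finset.sum_congr rfl fun q _ => ?_
  by_cases h : ∃ j, ℓ q j = l
  · obtain ⟨j, hj⟩ := h
    rw [if_pos ⟨j, hj⟩, Finset.sum_eq_single j, if_pos hj]
    · intro k _ hk
      exact if_neg fun hk' => hk (hℓ q (hk'.trans hj.symm))
    · simp
  · rw [if_neg h]
    push Not at h
    simp [h]

/-- The weighted graph Laplacian of the collinearity relation. -/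
noncomputable def collinearityLaplacian (ℓ : P → Fin d → Λ) : (P → ℝ) →ₗ[ℝ] (P → ℝ) where
  toFun α p := ∑ i, ∑ q ∈ pointsOn ℓ (ℓ p i), (α p - α q)
  map_add' α β := by
    funext p
    simp only [Pi.add_apply, ← Finset.sum_add_distrib]
    exact Finset.sum_congr rfl fun i _ => Finset.sum_congr rfl fun q _ => by ring
  map_smul' c α := by
    funext p
    simp only [Pi.smul_apply, smul_eq_mul, RingHom.id_apply, Finset.mul_sum]
    exact Finset.sum_congr rfl fun i _ => Finset.sum_congr rfl fun q _ => by ring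

/-- Antisymmetry in p and q. Injectivity of `ℓ q` lets the sum over points of a line be written as a
sum over pairs (q, j), symmetric with (p, i). -/
theorem sum_collinearityLaplacian {ℓ : P → Fin d → Λ} (hℓ : ∀ p, Function.Injective (ℓ p))
    (α : P → ℝ) : ∑ p, collinearityLaplacian ℓ α p = 0 := by
  classical
  have h : ∀ p, collinearityLaplacian ℓ α p =
      ∑ q, ∑ i, ∑ j, if ℓ q j = ℓ p i then α p - α q else 0 := fun p => by
    change ∑ i, ∑ q ∈ pointsOn ℓ (ℓ p i), (α p - α q) = _
    simp_rw [sum_pointsOn_eq hℓ]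
    exact Finset.sum_comm
  have hanti : ∑ p, collinearityLaplacian ℓ α p = -∑ p, collinearityLaplacian ℓ α p := by
    simp_rw [h]
    conv_lhs => rw [Finset.sum_comm]
    rw [← Finset.sum_neg_distrib]
    refine Finset.sum_congr rfl fun p _ => ?_
    rw [← Finset.sum_neg_distrib]
    refine Finset.sum_congr rfl fun q _ => ?_
    rw [Finset.sum_comm, ← Finset.sum_neg_distrib]
    refine Finset.sum_congr rfl fun i _ => ?_
    rw [← Finset.sum_neg_distrib]
    refine Finset.sum_congr rfl fun j _ => ?_
    by_cases hij : ℓ q j = ℓ p i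
    · rw [if_pos hij, if_pos hij.symm]; ring
    · rw [if_neg hij, if_neg (Ne.symm hij), neg_zero]
  linarith

/-- Maximum principle: the set where α is maximal is closed under sharing a chosen line. -/
theorem eq_const_of_collinearityLaplacian_eq_zero [Nonempty P] {ℓ : P → Fin d → Λ}
    (hconn : ∀ A : Finset P, A.Nonempty → (∀ p ∈ A, ∀ q i j, ℓ q j = ℓ p i → q ∈ A) → A = Finset.univ)
    {α : P → ℝ} (hα : collinearityLaplacian ℓ α = 0) : ∃ c, ∀ p, α p = c := by
  classical
  obtain ⟨p₀, -, hp₀⟩ := Finset.exists_max_image Finset.univ α Finset.univ_nonempty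
  have hA := hconn (Finset.univ.filter fun p => α p = α p₀) ⟨p₀, by simp⟩ (by
    intro p hp q i j hij
    simp only [Finset.mem_filter, Finset.mem_univ, true_and] at hp ⊢
    have hnn : ∀ i, ∀ q ∈ pointsOn ℓ (ℓ p i), 0 ≤ α p - α q := fun i q _ => by
      rw [hp]
      exact sub_nonneg.2 (hp₀ q (Finset.mem_univ q))
    have h0 : ∑ i, ∑ q ∈ pointsOn ℓ (ℓ p i), (α p - α q) = 0 := congrFun hα p
    have h1 := (Finset.sum_eq_zero_iff_of_nonneg fun i _ => Finset.sum_nonneg (hnn i)).1 h0 i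
      (Finset.mem_univ i)
    have h2 := (Finset.sum_eq_zero_iff_of_nonneg (hnn i)).1 h1 q (mem_pointsOn.2 ⟨j, hij⟩)
    linarith)
  refine ⟨α p₀, fun p => ?_⟩
  have : p ∈ Finset.univ.filter fun p => α p = α p₀ := by
    rw [hA]
    exact Finset.mem_univ p
  simpa using this

/-- The range lies in the hyperplane of sum zero, and the kernel has dimension at most 1, so
rank-nullity makes them equal. -/
theorem exists_collinearityLaplacian_eq [Nonempty P] {ℓ : P → Fin d → Λ}
    (hℓ : ∀ p, Function.Injective (ℓ p))
    (hconn : ∀ A : Finset P, A.Nonempty → (∀ p ∈ A, ∀ q i j, ℓ q j = ℓ p i → q ∈ A) → A = Finset.univ)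
    {τ : P → ℝ} (hτ : ∑ p, τ p = 0) : ∃ α, collinearityLaplacian ℓ α = τ := by
  classical
  set D := collinearityLaplacian ℓ with hD
  set σ : (P → ℝ) →ₗ[ℝ] ℝ := ∑ p, LinearMap.proj p with hσ
  have hσ_apply : ∀ α, σ α = ∑ p, α p := fun α => by simp [hσ]
  have hle : D.range ≤ σ.ker := by
    rintro _ ⟨α, rfl⟩
    rw [LinearMap.mem_ker, hσ_apply]
    exact sum_collinearityLaplacian hℓ α
  have hker : D.ker ≤ Submodule.span ℝ {fun _ => (1 : ℝ)} := fun α hα => by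
    obtain ⟨c, hc⟩ := eq_const_of_collinearityLaplacian_eq_zero hconn (LinearMap.mem_ker.1 hα)
    exact Submodule.mem_span_singleton.2 ⟨c, by funext p; simp [hc p]⟩
  have hker1 : Module.finrank ℝ D.ker ≤ 1 :=
    (Submodule.finrank_mono hker).trans
      (finrank_span_singleton fun h => one_ne_zero (congrFun h (Classical.arbitrary P))).le
  have hσ_surj : Function.Surjective σ := by
    refine LinearMap.surjective_of_ne_zero ?_
    intro h0
    have h1 := hσ_apply fun _ => 1
    rw [h0] at h1
    simp only [LinearMap.zero_apply, Finset.sum_const, Finset.card_univ, nsmul_eq_mul, mul_one] at h1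
    exact Fintype.card_ne_zero (α := P) (by exact_mod_cast h1.symm)
  have h1 := D.finrank_range_add_finrank_ker
  have h2 := σ.finrank_range_add_finrank_ker
  rw [LinearMap.range_eq_top.2 hσ_surj, finrank_top, Module.finrank_self] at h2
  have heq : D.range = σ.ker := Submodule.eq_of_le_of_finrank_le hle (by omega)
  have : τ ∈ D.range := by
    rw [heq, LinearMap.mem_ker, hσ_apply, hτ]
  exact this

end Laplacian

/-! ### Comparison of geometric and arithmetic means. -/

section Means

/-- By Hölder the geometric mean of the M_p, plus j, is at most the geometric mean of the M_p + j.
Multiply over j and apply AM-GM to the d-th roots. -/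
theorem prod_add_le_mean_pow {ι : Type*} [Fintype ι] [Nonempty ι] {d : ℕ} (hd : 0 < d) {M : ι → ℝ}
    (hM : ∀ p, 0 < M p) :
    ∏ j ∈ Finset.range d, ((∏ p, M p ^ (Fintype.card ι : ℝ)⁻¹) + j) ≤
      ((∑ p, (∏ j ∈ Finset.range d, (M p + j)) ^ (d : ℝ)⁻¹) / Fintype.card ι) ^ d := by
  have hd' : (d : ℝ) ≠ 0 := by exact_mod_cast hd.ne'
  have hN : (0 : ℝ) < Fintype.card ι := by exact_mod_cast Fintype.card_pos
  set N : ℝ := ((Fintype.card ι : ℕ) : ℝ) with hNdef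
  set Q : ι → ℝ := fun p => ∏ j ∈ Finset.range d, (M p + j) with hQ
  have hQ0 : ∀ p, 0 < Q p := fun p => Finset.prod_pos fun j _ => by
    have := hM p
    positivity
  have hgm : ∀ j : ℕ, (∏ p, M p ^ N⁻¹) + j ≤ ∏ p, (M p + j) ^ N⁻¹ := fun j => by
    have hpos : ∀ p, 0 < M p + j := fun p => by
      have := hM p
      positivity
    have h := Finset.sum_prod_rpow_inv_card_le_one (ι := ι) (Finset.univ : Finset (Fin 2))
      (c := fun p k => ![M p / (M p + j), j / (M p + j)] k)
      (fun p k => by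
        have := hM p
        fin_cases k <;> simp <;> positivity)
      (fun p => by
        rw [Fin.sum_univ_two]
        simp only [Matrix.cons_val_zero, Matrix.cons_val_one]
        rw [← add_div, div_self (hpos p).ne'])
    rw [Fin.sum_univ_two] at h
    simp only [Matrix.cons_val_zero, Matrix.cons_val_one, ← hNdef] at h
    simp_rw [Real.div_rpow (hM _).le (hpos _).le,
      Real.div_rpow (Nat.cast_nonneg j) (hpos _).le] at h
    rw [Finset.prod_div_distrib, Finset.prod_div_distrib, ← add_div,
      div_le_one (Finset.prod_pos fun p _ => Real.rpow_pos_of_pos (hpos p) _)] at h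
    refine le_trans (le_of_eq ?_) h
    congr 1
    rw [Finset.prod_const, Finset.card_univ, ← Real.rpow_natCast, ← Real.rpow_mul (Nat.cast_nonneg j),
      inv_mul_cancel₀ hN.ne', Real.rpow_one]
  have ham : ∏ p, (Q p ^ (d : ℝ)⁻¹) ^ N⁻¹ ≤ (∑ p, Q p ^ (d : ℝ)⁻¹) / N := by
    have := Real.geom_mean_le_arith_mean_weighted Finset.univ (fun _ : ι => N⁻¹)
      (fun p => Q p ^ (d : ℝ)⁻¹) (fun _ _ => by positivity) (by simp [← hNdef, hN.ne'])
      fun p _ => Real.rpow_nonneg (hQ0 p).le _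
    rwa [← Finset.mul_sum, ← div_eq_inv_mul] at this
  calc ∏ j ∈ Finset.range d, ((∏ p, M p ^ N⁻¹) + j)
      ≤ ∏ j ∈ Finset.range d, ∏ p, (M p + j) ^ N⁻¹ :=
        Finset.prod_le_prod (fun j _ => add_nonneg (Finset.prod_nonneg fun p _ =>
          Real.rpow_nonneg (hM p).le _) (Nat.cast_nonneg j)) fun j _ => hgm j
    _ = (∏ p, (Q p ^ (d : ℝ)⁻¹) ^ N⁻¹) ^ d := by
        rw [Finset.prod_comm, ← Finset.prod_pow]
        refine Finset.prod_congr rfl fun p _ => ?_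
        rw [Real.finsetProd_rpow _ _ fun j _ => add_nonneg (hM p).le (Nat.cast_nonneg j),
          ← Real.rpow_natCast, ← Real.rpow_mul (Real.rpow_nonneg (hQ0 p).le _),
          mul_comm N⁻¹, ← Real.rpow_mul (hQ0 p).le, ← mul_assoc, inv_mul_cancel₀ hd', one_mul]
    _ ≤ _ := by
        refine pow_le_pow_left₀ (Finset.prod_nonneg fun p _ => ?_) ham d
        exact Real.rpow_nonneg (Real.rpow_nonneg (hQ0 p).le _) _

theorem prod_le_mean_pow {d : ℕ} [NeZero d] {b : Fin d → ℝ} (hb : ∀ i, 0 ≤ b i) :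
    ∏ i, b i ≤ ((∑ i, b i) / d) ^ d := by
  have hd : (0 : ℝ) < d := by exact_mod_cast Nat.pos_of_ne_zero (NeZero.ne d)
  have := Real.geom_mean_le_arith_mean_weighted Finset.univ (fun _ : Fin d => (d : ℝ)⁻¹) b
    (fun _ _ => by positivity) (by simp [hd.ne']) fun i _ => hb i
  rw [← Finset.mul_sum, ← div_eq_inv_mul] at this
  have h := pow_le_pow_left₀ (Finset.prod_nonneg fun i _ => Real.rpow_nonneg (hb i) _) this d
  refine le_trans (le_of_eq ?_) h
  rw [← Finset.prod_pow]
  refine Finset.prod_congr rfl fun i _ => ?_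
  rw [← Real.rpow_natCast, ← Real.rpow_mul (hb i), inv_mul_cancel₀ hd.ne', Real.rpow_one]

end Means

/-! ### The inequality for connected configurations. -/

section Connected

open Filter Topology

variable {d : ℕ} {P Λ : Type*} [Fintype P]

/-- The geometric mean of the numbers of points on the chosen lines of `p`. -/
noncomputable def meanRichness (ℓ : P → Fin d → Λ) (p : P) : ℝ :=
  ∏ i, ((pointsOn ℓ (ℓ p i)).card : ℝ) ^ (d : ℝ)⁻¹

theorem one_le_card_pointsOn (ℓ : P → Fin d → Λ) (p : P) (i : Fin d) :
    (1 : ℝ) ≤ (pointsOn ℓ (ℓ p i)).card := by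
  exact_mod_cast Finset.card_pos.2 ⟨p, self_mem_pointsOn ℓ p i⟩

theorem one_le_meanRichness (ℓ : P → Fin d → Λ) (p : P) : 1 ≤ meanRichness ℓ p :=
  Finset.one_le_prod fun i _ => Real.one_le_rpow (one_le_card_pointsOn ℓ p i) (by positivity)

theorem pow_le_factorial_mul_choose (d n : ℕ) :
    (n : ℝ) ^ d ≤ d.factorial * ((d + n).choose n : ℕ) := by
  have h := Nat.pow_succ_le_ascFactorial (n + 1) d
  rw [Nat.ascFactorial_eq_factorial_mul_choose, add_comm n d, Nat.choose_symm_add] at h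
  calc (n : ℝ) ^ d ≤ ((n : ℝ) + 1) ^ d := by gcongr; linarith
    _ ≤ _ := by exact_mod_cast h

/-- Bound for the number of Taylor coefficients needed at a point. -/
theorem card_le_of_handicap [NeZero d] (ℓ : P → Fin d → Λ) (p : P) {α : P → ℝ} {T : ℝ} (hT : 0 ≤ T)
    (hα : collinearityLaplacian ℓ α p = d * (1 - T)) (n : ℕ) (s : Finset (Fin d → ℕ))
    (hs : ∀ γ ∈ s, ∀ i, ∑ q ∈ pointsOn ℓ (ℓ p i),
      ((γ i : ℤ) + ⌊n * α p⌋ - ⌊n * α q⌋).toNat + ∑ k ∈ Finset.univ.erase i, γ k ≤ n) :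
    (s.card : ℝ) ≤ (n * T + (2 * Fintype.card P + d)) ^ d /
      ∏ j ∈ Finset.range d, (meanRichness ℓ p + j) := by
  have hd : (0 : ℝ) < d := by exact_mod_cast Nat.pos_of_ne_zero (NeZero.ne d)
  have hden : 0 < ∏ j ∈ Finset.range d, (meanRichness ℓ p + j) := Finset.prod_pos fun j _ => by
    have := one_le_meanRichness ℓ p
    positivity
  rcases s.eq_empty_or_nonempty with rfl | hne
  · simp only [Finset.card_empty, Nat.cast_zero]
    positivity
  set m : Fin d → ℝ := fun i => (pointsOn ℓ (ℓ p i)).card with hm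
  -- The error term absorbs at most |P| from the floors and |P| + d from moving γ to the far corner
  -- of its cube.
  set b : Fin d → ℝ := fun i => n * (1 - ∑ q ∈ pointsOn ℓ (ℓ p i), (α p - α q)) +
    (2 * Fintype.card P + d) with hb
  have hm1 : ∀ i, 1 ≤ m i := one_le_card_pointsOn ℓ p
  have hbound : ∀ γ ∈ s, ∀ i, (m i - 1) * (γ i + 1) + ∑ k, ((γ k : ℝ) + 1) ≤ b i := by
    intro γ hγ i
    have h1 : (∑ q ∈ pointsOn ℓ (ℓ p i), (((γ i : ℤ) + ⌊n * α p⌋ - ⌊n * α q⌋ : ℤ) : ℝ)) +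
        ∑ k ∈ Finset.univ.erase i, (γ k : ℝ) ≤ n := by
      have h := hs γ hγ i
      have h' : (∑ q ∈ pointsOn ℓ (ℓ p i), (((γ i : ℤ) + ⌊n * α p⌋ - ⌊n * α q⌋).toNat : ℝ)) +
        ∑ k ∈ Finset.univ.erase i, (γ k : ℝ) ≤ n := by exact_mod_cast h
      refine le_trans ?_ h'
      gcongr with q
      exact_mod_cast Int.self_le_toNat _
    have h2 : ∑ q ∈ pointsOn ℓ (ℓ p i), (γ i + n * (α p - α q) - 1) ≤
        ∑ q ∈ pointsOn ℓ (ℓ p i), (((γ i : ℤ) + ⌊n * α p⌋ - ⌊n * α q⌋ : ℤ) : ℝ) := by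
      refine Finset.sum_le_sum fun q _ => ?_
      have h3 := Int.lt_floor_add_one (n * α p)
      have h4 := Int.floor_le (n * α q)
      push_cast
      linarith
    have h3 : ∑ q ∈ pointsOn ℓ (ℓ p i), (γ i + n * (α p - α q) - 1) =
        m i * γ i + n * ∑ q ∈ pointsOn ℓ (ℓ p i), (α p - α q) - m i := by
      rw [Finset.sum_sub_distrib, Finset.sum_add_distrib, ← Finset.mul_sum]
      simp [hm]
    have h4 : ∑ k, ((γ k : ℝ) + 1) = γ i + ∑ k ∈ Finset.univ.erase i, (γ k : ℝ) + d := by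
      rw [Finset.sum_add_distrib, ← Finset.add_sum_erase _ _ (Finset.mem_univ i)]
      simp
    have h5 : m i ≤ Fintype.card P := by
      exact Nat.cast_le.2 (Finset.card_le_univ (pointsOn ℓ (ℓ p i)))
    rw [h4]
    simp only [hb]
    linarith
  have hb0 : ∀ i, 0 < b i := fun i => by
    obtain ⟨γ, hγ⟩ := hne
    refine lt_of_lt_of_le ?_ (hbound γ hγ i)
    have h1 : 0 ≤ (m i - 1) * ((γ i : ℝ) + 1) :=
      mul_nonneg (sub_nonneg.2 (hm1 i)) (by positivity)
    have h2 : 0 < ∑ k, ((γ k : ℝ) + 1) :=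
      Finset.sum_pos (fun k _ => by positivity) ⟨i, Finset.mem_univ i⟩
    linarith
  refine (card_lattice_points_le hm1 hb0 s hbound).trans ?_
  change _ / ∏ j ∈ Finset.range d, (meanRichness ℓ p + j) ≤ _
  refine div_le_div_of_nonneg_right ((prod_le_mean_pow fun i => (hb0 i).le).trans (le_of_eq ?_))
    hden.le
  congr 1
  have hα' : ∑ i, ∑ q ∈ pointsOn ℓ (ℓ p i), (α p - α q) = d * (1 - T) := hα
  simp only [hb]
  rw [Finset.sum_add_distrib, ← Finset.mul_sum, Finset.sum_sub_distrib, hα']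
  simp only [Finset.sum_const, Finset.card_univ, Fintype.card_fin, nsmul_eq_mul]
  field_simp
  ring

/-- Divide by n^d and let n → ∞; the bounded error C disappears. -/
theorem le_sum_of_forall_choose_le {Q T : P → ℝ} {C : ℝ}
    (h : ∀ n : ℕ, (((d + n).choose n : ℕ) : ℝ) ≤ ∑ p, (n * T p + C) ^ d / Q p) :
    1 ≤ d.factorial * ∑ p, T p ^ d / Q p := by
  have hlim : Tendsto (fun n : ℕ => d.factorial * ∑ p, (T p + C / n) ^ d / Q p) atTop
      (𝓝 (d.factorial * ∑ p, (T p + 0) ^ d / Q p)) := by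
    refine (tendsto_finsetSum _ fun p _ => ?_).const_mul _
    exact ((tendsto_const_nhds.add (tendsto_const_div_atTop_nhds_zero_nat C)).pow d).div_const _
  simp_rw [add_zero] at hlim
  refine ge_of_tendsto hlim ?_
  filter_upwards [eventually_gt_atTop 0] with n hn
  have hn' : (0 : ℝ) < n := by exact_mod_cast hn
  have h1 := (pow_le_factorial_mul_choose d n).trans
    (mul_le_mul_of_nonneg_left (h n) (Nat.cast_nonneg d.factorial))
  have h2 : ∑ p, (n * T p + C) ^ d / Q p = n ^ d * ∑ p, (T p + C / n) ^ d / Q p := by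
    rw [Finset.mul_sum]
    refine Finset.sum_congr rfl fun p _ => ?_
    rw [← mul_div_assoc, ← mul_pow, mul_add, mul_div_cancel₀ _ hn'.ne']
  rw [h2, ← mul_assoc, mul_comm (d.factorial : ℝ), mul_assoc] at h1
  exact (le_mul_iff_one_le_right (pow_pos hn' d)).1 h1

theorem prod_meanRichness_add_le [Nonempty P] [NeZero d] {ℓ : P → Fin d → Λ}
    (hℓ : ∀ p, Function.Injective (ℓ p))
    (hconn : ∀ A : Finset P, A.Nonempty → (∀ p ∈ A, ∀ q i j, ℓ q j = ℓ p i → q ∈ A) → A = Finset.univ)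
    (hcount : ∀ (n : ℕ) (a : P → ℤ) (Γ : P → Finset (Fin d → ℕ)),
      (∀ p (γ : Fin d → ℕ), (∀ i, ∑ q ∈ pointsOn ℓ (ℓ p i), ((γ i : ℤ) + a p - a q).toNat +
        ∑ k ∈ Finset.univ.erase i, γ k ≤ n) → γ ∈ Γ p) →
      (d + n).choose n ≤ ∑ p, (Γ p).card) :
    ∏ j ∈ Finset.range d, ((∏ p, meanRichness ℓ p ^ (Fintype.card P : ℝ)⁻¹) + j) ≤
      d.factorial * Fintype.card P := by
  classical
  have hN : (0 : ℝ) < Fintype.card P := by exact_mod_cast Fintype.card_pos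
  have hd : (d : ℝ) ≠ 0 := by exact_mod_cast NeZero.ne d
  have hM0 : ∀ p, 0 < meanRichness ℓ p := fun p => one_pos.trans_le (one_le_meanRichness ℓ p)
  refine (prod_add_le_mean_pow (Nat.pos_of_ne_zero (NeZero.ne d)) hM0).trans ?_
  set Q : P → ℝ := fun p => ∏ j ∈ Finset.range d, (meanRichness ℓ p + j) with hQ
  have hQ0 : ∀ p, 0 < Q p := fun p => Finset.prod_pos fun j _ => by
    have := hM0 p
    positivity
  set S : ℝ := (∑ p, Q p ^ (d : ℝ)⁻¹) / Fintype.card P with hS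
  have hS0 : 0 < S := div_pos (Finset.sum_pos (fun p _ => Real.rpow_pos_of_pos (hQ0 p) _)
    Finset.univ_nonempty) hN
  -- This choice makes all T_p^d / Q_p equal to 1/S^d. Dividing by the mean `S` gives ∑ T_p = |P|,
  -- exactly the solvability condition for the Laplacian.
  set T : P → ℝ := fun p => Q p ^ (d : ℝ)⁻¹ / S with hT
  have hT0 : ∀ p, 0 ≤ T p := fun p => div_nonneg (Real.rpow_nonneg (hQ0 p).le _) hS0.le
  have hTsum : ∑ p, T p = Fintype.card P := by
    rw [hT, ← Finset.sum_div]
    rw [div_eq_iff hS0.ne', hS]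
    field_simp
  obtain ⟨α, hα⟩ := exists_collinearityLaplacian_eq hℓ hconn (τ := fun p => d * (1 - T p)) (by
    rw [← Finset.mul_sum, Finset.sum_sub_distrib, hTsum]
    simp)
  have hmain := le_sum_of_forall_choose_le (d := d) (Q := Q) (T := T)
    (C := 2 * Fintype.card P + d) fun n => by
      set Γ : P → Finset (Fin d → ℕ) := fun p =>
        (Fintype.piFinset fun _ => Finset.range (n + 1)).filter fun γ =>
          ∀ i, ∑ q ∈ pointsOn ℓ (ℓ p i), ((γ i : ℤ) + ⌊n * α p⌋ - ⌊n * α q⌋).toNat +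
            ∑ k ∈ Finset.univ.erase i, γ k ≤ n with hΓ
      have h := hcount n (fun p => ⌊n * α p⌋) Γ fun p γ hγ => by
        refine Finset.mem_filter.2 ⟨Fintype.mem_piFinset.2 fun i => Finset.mem_range.2 ?_, hγ⟩
        have h1 := hγ i
        have h2 : ((γ i : ℤ) + ⌊n * α p⌋ - ⌊n * α p⌋).toNat ≤
            ∑ q ∈ pointsOn ℓ (ℓ p i), ((γ i : ℤ) + ⌊n * α p⌋ - ⌊n * α q⌋).toNat :=
          Finset.single_le_sum (f := fun q => ((γ i : ℤ) + ⌊n * α p⌋ - ⌊n * α q⌋).toNat)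
            (fun _ _ => Nat.zero_le _) (self_mem_pointsOn ℓ p i)
        rw [add_sub_cancel_right, Int.toNat_natCast] at h2
        omega
      calc (((d + n).choose n : ℕ) : ℝ) ≤ ∑ p, ((Γ p).card : ℝ) := by exact_mod_cast h
        _ ≤ _ := Finset.sum_le_sum fun p _ => card_le_of_handicap ℓ p (hT0 p) (congrFun hα p) n _
          fun γ hγ => (Finset.mem_filter.1 hγ).2
  have hterm : ∀ p, T p ^ d / Q p = 1 / S ^ d := fun p => by
    rw [hT, div_pow, ← Real.rpow_natCast (Q p ^ (d : ℝ)⁻¹), ← Real.rpow_mul (hQ0 p).le,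
      inv_mul_cancel₀ hd, Real.rpow_one]
    have := (hQ0 p).ne'
    field_simp
  simp_rw [hterm] at hmain
  rw [Finset.sum_const, Finset.card_univ, nsmul_eq_mul, mul_one_div, ← mul_div_assoc,
    one_le_div (pow_pos hS0 d)] at hmain
  exact hmain

/-- A line chosen by m points occurs for m pairs (p, i), each of weight 1/m. -/
theorem sum_inv_card_pointsOn [DecidableEq Λ] {ℓ : P → Fin d → Λ}
    (hℓ : ∀ p, Function.Injective (ℓ p)) :
    ∑ p, ∑ i, ((pointsOn ℓ (ℓ p i)).card : ℝ)⁻¹ =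
      (Finset.univ.image fun x : P × Fin d => ℓ x.1 x.2).card := by
  rw [← Fintype.sum_prod_type' (f := fun p i => ((pointsOn ℓ (ℓ p i)).card : ℝ)⁻¹),
    ← Finset.sum_fiberwise_of_maps_to (t := Finset.univ.image fun x : P × Fin d => ℓ x.1 x.2)
      (g := fun x : P × Fin d => ℓ x.1 x.2) fun x hx => Finset.mem_image_of_mem _ hx,
    Finset.card_eq_sum_ones, Nat.cast_sum]
  refine Finset.sum_congr rfl fun l hl => ?_
  have hcard : (Finset.univ.filter fun x : P × Fin d => ℓ x.1 x.2 = l).card =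
      (pointsOn ℓ l).card := by
    refine Finset.card_bij (fun x _ => x.1) (fun x hx => ?_) (fun x hx y hy hxy => ?_) fun q hq => ?_
    · exact mem_pointsOn.2 ⟨x.2, (Finset.mem_filter.1 hx).2⟩
    · refine Prod.ext hxy (hℓ x.1 ?_)
      rw [(Finset.mem_filter.1 hx).2, hxy, (Finset.mem_filter.1 hy).2]
    · obtain ⟨j, hj⟩ := mem_pointsOn.1 hq
      exact ⟨(q, j), by simpa using hj, rfl⟩
  have hpos : ((pointsOn ℓ l).card : ℝ) ≠ 0 := by
    obtain ⟨x, -, rfl⟩ := Finset.mem_image.1 hl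
    exact (one_pos.trans_le (one_le_card_pointsOn ℓ x.1 x.2)).ne'
  calc ∑ x ∈ Finset.univ.filter fun x : P × Fin d => ℓ x.1 x.2 = l,
        ((pointsOn ℓ (ℓ x.1 x.2)).card : ℝ)⁻¹
      = ∑ _x ∈ Finset.univ.filter fun x : P × Fin d => ℓ x.1 x.2 = l,
        ((pointsOn ℓ l).card : ℝ)⁻¹ :=
        Finset.sum_congr rfl fun x hx => by rw [(Finset.mem_filter.1 hx).2]
    _ = ((1 : ℕ) : ℝ) := by
        rw [Finset.sum_const, hcard, nsmul_eq_mul, mul_inv_cancel₀ hpos, Nat.cast_one]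

/-- AM-GM for the reciprocals 1/m over the d|P| pairs: their geometric mean is 1/y and their sum is
the number of lines. -/
theorem mul_card_le_meanRichness_mul_card [Nonempty P] [NeZero d] [DecidableEq Λ]
    {ℓ : P → Fin d → Λ} (hℓ : ∀ p, Function.Injective (ℓ p)) :
    (d : ℝ) * Fintype.card P ≤ (∏ p, meanRichness ℓ p ^ (Fintype.card P : ℝ)⁻¹) *
      (Finset.univ.image fun x : P × Fin d => ℓ x.1 x.2).card := by
  have hN : (0 : ℝ) < Fintype.card P := by exact_mod_cast Fintype.card_pos
  have hd : (0 : ℝ) < d := by exact_mod_cast Nat.pos_of_ne_zero (NeZero.ne d)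
  have hm0 : ∀ p i, (0 : ℝ) < (pointsOn ℓ (ℓ p i)).card := fun p i =>
    one_pos.trans_le (one_le_card_pointsOn ℓ p i)
  set y : ℝ := ∏ p, meanRichness ℓ p ^ (Fintype.card P : ℝ)⁻¹ with hy
  have hy0 : 0 < y := Finset.prod_pos fun p _ =>
    Real.rpow_pos_of_pos (one_pos.trans_le (one_le_meanRichness ℓ p)) _
  have ham := Real.geom_mean_le_arith_mean_weighted (Finset.univ : Finset (P × Fin d))
    (fun _ => ((d : ℝ) * Fintype.card P)⁻¹) (fun x => ((pointsOn ℓ (ℓ x.1 x.2)).card : ℝ)⁻¹)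
    (fun _ _ => by positivity)
    (by
      rw [Finset.sum_const, Finset.card_univ, Fintype.card_prod, Fintype.card_fin, nsmul_eq_mul]
      push_cast
      field_simp)
    (fun x _ => by positivity)
  rw [← Finset.mul_sum, Fintype.sum_prod_type, sum_inv_card_pointsOn hℓ] at ham
  have hgm : ∏ x : P × Fin d, ((pointsOn ℓ (ℓ x.1 x.2)).card : ℝ)⁻¹ ^
      ((d : ℝ) * Fintype.card P)⁻¹ = y⁻¹ := by
    rw [Fintype.prod_prod_type, hy, ← Finset.prod_inv_distrib]
    refine Finset.prod_congr rfl fun p _ => ?_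
    rw [meanRichness, ← Real.finsetProd_rpow _ _ fun i _ => Real.rpow_nonneg (hm0 p i).le _,
      ← Finset.prod_inv_distrib]
    refine Finset.prod_congr rfl fun i _ => ?_
    rw [← Real.rpow_mul (hm0 p i).le, Real.inv_rpow (hm0 p i).le, mul_inv]
  rw [hgm, inv_mul_eq_div, le_div_iff₀ (by positivity), inv_mul_eq_div, div_le_iff₀ hy0] at ham
  linarith

end Connected

theorem Ring.choose_real_eq_prod_div (x : ℝ) (k : ℕ) :
    Ring.choose x k = (∏ j ∈ Finset.range k, (x - j)) / k.factorial := by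
  have h := Ring.descPochhammer_eq_factorial_smul_choose x k
  rw [← Polynomial.aeval_eq_smeval, ← Polynomial.eval_map_algebraMap, descPochhammer_map,
    descPochhammer_eval_eq_prod_range, nsmul_eq_mul] at h
  rw [h, mul_div_cancel_left₀ _ (by positivity)]

/-! ### Reduction to connected configurations, and the theorem. -/

section Joints

variable {F : Type*} [Field F] {d : ℕ} {P Λ : Type*}

/-- The bound on `S.card` passes to subsets with the same `Y`, and the conclusion is additive over
parts that share no chosen line; hence the strong induction on `S`. -/
theorem mul_card_le_mul_card_lines [NeZero d] [DecidableEq Λ] {pt : P → Fin d → F}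
    (hpt : Function.Injective pt) {v : P → Fin d → Fin d → F}
    (hv : ∀ p, LinearIndependent F (v p)) {ℓ : P → Fin d → Λ}
    (hinj : ∀ p, Function.Injective (ℓ p))
    (hℓ : ∀ p i q j, ℓ q j = ℓ p i → ∃ t : F, pt q = pt p + t • v p i) {Y : ℝ} (hY : 0 < Y)
    (S : Finset P) (hS : (d.factorial : ℝ) * S.card ≤ ∏ j ∈ Finset.range d, (Y + j)) :
    (d : ℝ) * S.card ≤ Y * (S.biUnion fun p => Finset.univ.image (ℓ p)).card := by
  classical
  induction S using Finset.strongInduction with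
  | H S ih =>
    rcases S.eq_empty_or_nonempty with rfl | hne
    · simp
    have : Nonempty S := hne.to_subtype
    by_cases hconn : ∀ A : Finset S, A.Nonempty →
        (∀ p ∈ A, ∀ q : S, ∀ i j, ℓ q j = ℓ p i → q ∈ A) → A = Finset.univ
    · have hinj' : ∀ p : S, Function.Injective (ℓ p) := fun p => hinj p
      have h1 := prod_meanRichness_add_le (ℓ := fun p : S => ℓ p) hinj' hconn
        fun n a Γ hΓ => choose_le_sum_card (pt := fun p : S => pt p) (v := fun p : S => v p)
          (fun p q hpq => Subtype.ext (hpt hpq)) (fun p => hv p)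
          (fun p i q j h => hℓ p i q j h) n a Γ hΓ
      have h2 := mul_card_le_meanRichness_mul_card (ℓ := fun p : S => ℓ p) hinj'
      rw [Fintype.card_coe] at h1 h2
      have himage : (Finset.univ.image fun x : S × Fin d => ℓ x.1 x.2) =
          S.biUnion fun p => Finset.univ.image (ℓ p) := by
        ext l
        simp
      rw [himage] at h2
      generalize ∏ p : S, meanRichness (fun p : S => ℓ p) p ^ (S.card : ℝ)⁻¹ = y at h1 h2
      have hyY : y ≤ Y := by
        by_contra hlt
        push Not at hlt
        have hprod : ∏ j ∈ Finset.range d, (Y + j) < ∏ j ∈ Finset.range d, (y + j) :=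
          Finset.prod_lt_prod_of_nonempty (fun j _ => by positivity)
            (fun j _ => by linarith) (by simpa using NeZero.ne d)
        linarith
      exact h2.trans (mul_le_mul_of_nonneg_right hyY (Nat.cast_nonneg _))
    · push Not at hconn
      obtain ⟨A, hA, hclosed, hAne⟩ := hconn
      set A' : Finset P := A.map (Function.Embedding.subtype _) with hA'
      have hmemA : ∀ {p} (hp : p ∈ S), p ∈ A' ↔ ⟨p, hp⟩ ∈ A := fun {p} hp => by
        simp [hA', hp]
      have hA'S : A' ⊆ S := fun p hp => by
        obtain ⟨q, -, rfl⟩ := Finset.mem_map.1 hp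
        exact q.2
      have hA'ne : A' ≠ S := fun h => hAne <| Finset.eq_univ_of_forall fun p =>
        (hmemA p.2).1 (by rw [h]; exact p.2)
      have hsplit : A'.card + (S \ A').card = S.card := by
        rw [add_comm]
        exact Finset.card_sdiff_add_card_eq_card hA'S
      have hle : ∀ T ⊂ S, (d : ℝ) * T.card ≤ Y * (T.biUnion fun p => Finset.univ.image (ℓ p)).card :=
        fun T hT => ih T hT (le_trans (by
          have := Finset.card_le_card hT.subset
          gcongr) hS)
      have h1 := hle A' (Finset.ssubset_iff_subset_ne.2 ⟨hA'S, hA'ne⟩)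
      have h2 := hle (S \ A') (Finset.sdiff_ssubset hA'S (hA.map))
      have hdisj : Disjoint (A'.biUnion fun p => Finset.univ.image (ℓ p))
          ((S \ A').biUnion fun p => Finset.univ.image (ℓ p)) := by
        rw [Finset.disjoint_left]
        intro l hl hl'
        simp only [Finset.mem_biUnion, Finset.mem_image, Finset.mem_univ, true_and,
          Finset.mem_sdiff] at hl hl'
        obtain ⟨p, hp, i, rfl⟩ := hl
        obtain ⟨q, ⟨hq, hqA⟩, j, hj⟩ := hl'
        exact hqA ((hmemA hq).2 (hclosed ⟨p, hA'S hp⟩ ((hmemA _).1 hp) ⟨q, hq⟩ i j hj))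
      have hunion : (S.biUnion fun p => Finset.univ.image (ℓ p)).card =
          (A'.biUnion fun p => Finset.univ.image (ℓ p)).card +
            ((S \ A').biUnion fun p => Finset.univ.image (ℓ p)).card := by
        rw [← Finset.card_union_of_disjoint hdisj, ← Finset.union_biUnion,
          Finset.union_sdiff_of_subset hA'S]
      rw [hunion, ← hsplit]
      push_cast
      linarith

theorem exists_eq_add_smul_of_mem_line {l : AffineSubspace F (Fin d → F)} (hl : IsLine l)
    {p q v : Fin d → F} (hp : p ∈ l) (hq : q ∈ l) (hv : v ∈ l.direction) (hv0 : v ≠ 0) :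
    ∃ t : F, q = p + t • v := by
  have hqp : q -ᵥ p ∈ l.direction := AffineSubspace.vsub_mem_direction hq hp
  obtain ⟨t, ht⟩ := (finrank_eq_one_iff_of_nonzero' (⟨v, hv⟩ : l.direction)
    (fun h => hv0 (congrArg Subtype.val h))).1 hl ⟨q -ᵥ p, hqp⟩
  refine ⟨t, ?_⟩
  have : t • v = q - p := congrArg Subtype.val ht
  rw [this]
  abel

theorem injective_of_linearIndependent_of_mem_direction {ℓ : Fin d → AffineSubspace F (Fin d → F)}
    {v : Fin d → Fin d → F} (hℓ : ∀ i, IsLine (ℓ i)) (hv : ∀ i, v i ∈ (ℓ i).direction)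
    (hind : LinearIndependent F v) : Function.Injective ℓ := by
  intro i j hij
  by_contra hne
  have hvj : v j ∈ (ℓ i).direction := hij ▸ hv j
  obtain ⟨t, ht⟩ := (finrank_eq_one_iff_of_nonzero' (⟨v i, hv i⟩ : (ℓ i).direction)
    (fun h => hind.ne_zero i (congrArg Subtype.val h))).1 (hℓ i) ⟨v j, hvj⟩
  have htv : t • v i = v j := congrArg Subtype.val ht
  refine hind.notMem_span_image (s := {i}) (x := j) (Ne.symm hne) ?_
  rw [Set.image_singleton]
  exact Submodule.mem_span_singleton.2 ⟨t, htv⟩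

end Joints

theorem theorem1p2 {F : Type*} [Field F] {d : ℕ} (hd : 1 ≤ d)
    (J : Set (Fin d → F)) (L : Set (AffineSubspace F (Fin d → F)))
    (hJL : IsJointsConfiguration J L) (x : ℝ) (hx : (d : ℝ) ≤ x)
    (hJ : (J.encard : ℝ≥0∞) = ENNReal.ofReal (Ring.choose x d)) :
    ENNReal.ofReal (Ring.choose x (d - 1)) ≤ (L.encard : ℝ≥0∞) := by
  classical
  have hd0 : NeZero d := ⟨by omega⟩
  by_cases hL : L.Finite
  swap
  · rw [Set.Infinite.encard_eq hL]
    simp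
  have hJfin : J.Finite := by
    by_contra h
    rw [Set.Infinite.encard_eq h] at hJ
    exact ENNReal.ofReal_ne_top hJ.symm
  have := hJfin.fintype
  have hjoint : ∀ p : J, IsJoint L p.1 := fun p => hJL.isJoint p p.2
  choose ℓ v hℓv hind using hjoint
  have hline : ∀ p i, IsLine (ℓ p i) := fun p i => hJL.isLine _ (hℓv p i).1
  -- The smallest factor of x(x-1)⋯(x-d+1), so that this product reads Y(Y+1)⋯(Y+d-1); it is also
  -- the ratio of d·C(x,d) to C(x,d-1).
  set Y : ℝ := x - d + 1 with hY
  have hY0 : 0 < Y := by linarith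
  have hprod : ∏ j ∈ Finset.range d, (x - j) = ∏ j ∈ Finset.range d, (Y + j) := by
    rw [← Finset.prod_range_reflect]
    refine Finset.prod_congr rfl fun j hj => ?_
    have := Finset.mem_range.1 hj
    rw [hY, Nat.cast_sub (by omega), Nat.cast_sub (by omega)]
    push_cast
    ring
  have hfac : (0 : ℝ) < d.factorial := by exact_mod_cast d.factorial_pos
  have hchoose : Ring.choose x d = (∏ j ∈ Finset.range d, (Y + j)) / d.factorial := by
    rw [Ring.choose_real_eq_prod_div, hprod]
  have hchoose0 : 0 ≤ Ring.choose x d := by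
    rw [hchoose]
    exact div_nonneg (Finset.prod_nonneg fun j _ => by positivity) hfac.le
  have hcard : (Fintype.card J : ℝ) = Ring.choose x d := by
    rw [Set.encard_eq_coe_toFinset_card, Set.toFinset_card, ENat.toENNReal_coe,
      ← ENNReal.ofReal_natCast] at hJ
    exact (ENNReal.ofReal_eq_ofReal_iff (Nat.cast_nonneg _) hchoose0).1 hJ
  have hmain := mul_card_le_mul_card_lines (pt := fun p : J => p.1) Subtype.val_injective hind
    (fun p => injective_of_linearIndependent_of_mem_direction (hline p)
      (fun i => (hℓv p i).2.2) (hind p))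
    (fun p i q j h => exists_eq_add_smul_of_mem_line (hline p i) (hℓv p i).2.1
      (h ▸ (hℓv q j).2.1) (hℓv p i).2.2 ((hind p).ne_zero i)) hY0 Finset.univ (by
      rw [Finset.card_univ, hcard, hchoose, mul_div_cancel₀ _ hfac.ne'])
  rw [Finset.card_univ, hcard] at hmain
  have hpred : (d : ℝ) * Ring.choose x d = Y * Ring.choose x (d - 1) := by
    obtain ⟨e, rfl⟩ : ∃ e, d = e + 1 := ⟨d - 1, by omega⟩
    rw [Ring.choose_real_eq_prod_div, Ring.choose_real_eq_prod_div, Nat.add_sub_cancel,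
      Finset.prod_range_succ, Nat.factorial_succ, hY]
    have : (e.factorial : ℝ) ≠ 0 := by positivity
    push_cast
    field_simp
    ring
  rw [hpred] at hmain
  have hle := le_of_mul_le_mul_left hmain hY0
  set K := Finset.univ.biUnion fun p : J => Finset.univ.image (ℓ p) with hK
  have hKL : (K : Set (AffineSubspace F (Fin d → F))) ⊆ L := fun l hl => by
    simp only [hK, Finset.coe_biUnion, Set.mem_iUnion, Finset.coe_image, Set.mem_image] at hl
    obtain ⟨p, -, i, -, rfl⟩ := hl
    exact (hℓv p i).1
  calc ENNReal.ofReal (Ring.choose x (d - 1)) ≤ ENNReal.ofReal K.card :=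
        ENNReal.ofReal_le_ofReal hle
    _ = ((K : Set (AffineSubspace F (Fin d → F))).encard : ℝ≥0∞) := by
        rw [Set.encard_coe_eq_coe_finsetCard, ENNReal.ofReal_natCast, ENat.toENNReal_coe]
    _ ≤ (L.encard : ℝ≥0∞) := ENat.toENNReal_le.2 (Set.encard_le_encard hKL)
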